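/- Linear regression. There are $M$ players and a dimension $D$. The players draw their parameters $(\theta_i,\epsilon_i)\in\mathbb R^D\times\mathbb R$ i.i.d. from a common distribution $\Theta$ under which the coordinates $\theta^1,\dots,\theta^D$ are independent with finite variances $\sigma_d^2=\mathrm{Var}(\theta^d)$, and $\mu_e=\mathbb E[\epsilon_i]$ is finite. Independently of each other, the players draw $n_i$ i.i.d. input points from their own input distribution $\mathcal X_i$ on $\mathbb R^D$, which has finite second moments $\Sigma_i=\mathbb E_{x\sim\mathcal X_i}[xx^T]$; these are the rows of the $n_i\times D$ matrix $X_i$, and $X_i^TX_i$ is assumed almost surely invertible. Given its parameters and inputs, player $i$ observes independent labels $Y_i$; the label at the input $x$ is drawn from a distribution with mean $x^T\theta_i$ and variance $\epsilon_i$. Let $\hat\theta_i=(X_i^TX_i)^{-1}X_i^TY_i$ be the ordinary least squares estimate. Fix a player $j$ and real weights $v_{ji}$ with $\sum_{i=1}^M v_{ji}=1$, and let $\hat\theta_j^v=\sum_{i=1}^M v_{ji}\hat\theta_i$ be the fine-grained federated estimate. The expected MSE of player $j$ is $\mathbb E[(x^T\hat\theta_j^v-x^T\theta_j)^2]$, where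 the expectation is over all parameters, inputs and labels and over an independent test point $x\sim\mathcal X_j$. (a) If the expectations $\mathbb E[(X_i^TX_i)^{-1}]$ exist (entrywise) for all $i$, then the expected MSE of player $j$ is finite and equals $$L_j+\Big(\sum_{i\ne j}v_{ji}^2+\Big(\sum_{i\ne j}v_{ji}\Big)^2\Big)\sum_{d=1}^D\mathbb E_{x\sim\mathcal X_j}[(x^d)^2]\,\sigma_d^2,\qquad L_j=\mu_e\sum_{i=1}^M v_{ji}^2\,\mathrm{tr}\big[\Sigma_j\,\mathbb E[(X_i^TX_i)^{-1}]\big].$$ (b) If every $\mathcal X_i$ is a $D$-dimensional normal distribution with mean $0$ and $n_i>D+1$ for all $i$, then the expectations $\mathbb E[(X_i^TX_i)^{-1}]$ exist and $$L_j=\mu_e\sum_{i=1}^M v_{ji}^2\,\frac{\mathrm{tr}(\Sigma_j\Sigma_i^{-1})}{n_i-D-1};$$ if moreover $\Sigma_i=\Sigma_j$ for every $i$ with $v_{ji}\neq0$, then $$L_j=\mu_e\sum_{i=1}^M v_{ji}^2\,\frac{D}{n_i-D-1}.$$ (c) Mean estimation. Suppose instead that the players draw $(\theta_i,\epsilon_i)\in\mathbb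 R\times\mathbb R$ i.i.d. with $\sigma^2=\mathrm{Var}(\theta_i)$ and $\mu_e=\mathbb E[\epsilon_i]$ finite, and that player $i$, given its parameters and independently of the other players, draws $n_i\ge1$ i.i.d. samples from a distribution with mean $\theta_i$ and variance $\epsilon_i$. Let $\hat\theta_i$ be the mean of these samples. Then the expected MSE $\mathbb E\big[\big(\sum_{i}v_{ji}\hat\theta_i-\theta_j\big)^2\big]$ of player $j$ is finite and equals $$\mu_e\sum_{i=1}^M v_{ji}^2\,\frac1{n_i}+\Big(\sum_{i\ne j}v_{ji}^2+\Big(\sum_{i\ne j}v_{ji}\Big)^2\Big)\sigma^2 .$$ -/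

import Mathlib

open MeasureTheory ProbabilityTheory Matrix

noncomputable section

namespace Federation

/-- Given the value `a`, draw `n` i.i.d. samples from the probability measure `κ a`. -/
def iidKernel {α β : Type*} [MeasurableSpace α] [MeasurableSpace β]
    (κ : Kernel α β) [IsMarkovKernel κ] (n : ℕ) : Kernel α (Fin n → β) where
  toFun a := Measure.pi fun _ : Fin n => κ a
  measurable' := by
    apply Measurable.measure_of_isPiSystem_of_isProbabilityMeasure
      (generateFrom_pi (α := fun _ : Fin n => β)).symm isPiSystem_pi
    rintro _ ⟨s, hs, rfl⟩
    simp only [Measure.pi_pi]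
    exact Finset.measurable_prod _ fun l _ =>
      Kernel.measurable_coe κ (hs l (Set.mem_univ l))

/-- The weight `∑_{i ≠ j} v_i² + (∑_{i ≠ j} v_i)²` of the bias part of the error of player `j`. -/
def biasWeight {M : ℕ} (v : Fin M → ℝ) (j : Fin M) : ℝ :=
  (∑ i ∈ Finset.univ.erase j, v i ^ 2) + (∑ i ∈ Finset.univ.erase j, v i) ^ 2

/-! ### Linear regression -/

/-- The data of the federated linear regression problem with `M` players in dimension `D`. -/
structure RegressionModel (M D : ℕ) where
  /-- number of samples of each player -/
  n : Fin M → ℕ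
  /-- the common law of the parameters `(θ_i, ε_i)` (coefficients, noise level) of a player -/
  paramDist : Measure ((Fin D → ℝ) × ℝ)
  /-- input distribution of each player -/
  inputDist : Fin M → Measure (Fin D → ℝ)
  /-- `labelDist i (m, e)` is the law of a label of player `i` with mean `m` and noise level `e` -/
  labelDist : Fin M → Kernel (ℝ × ℝ) ℝ
  isProb_param : IsProbabilityMeasure paramDist
  isProb_input : ∀ i, IsProbabilityMeasure (inputDist i)
  isMarkov_label : ∀ i, IsMarkovKernel (labelDist i)

namespace RegressionModel

attribute [instance] isProb_param isProb_input isMarkov_label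

variable {M D : ℕ} (R : RegressionModel M D)

/-- The `n × D` matrix of inputs has the input points as its rows; this is `Xᵀ X`. -/
def gram {n : ℕ} (X : Matrix (Fin n) (Fin D) ℝ) : Matrix (Fin D) (Fin D) ℝ := Xᵀ * X

/-- The law of the inputs `X_i` of player `i`: `n_i` i.i.d. rows drawn from its input
distribution. -/
def designLaw (i : Fin M) : Measure (Fin (R.n i) → Fin D → ℝ) :=
  Measure.pi fun _ => R.inputDist i

/-- The assumptions of the model. -/
structure Standing : Prop where
  /-- the coefficients have finite second moments -/
  coeff_memLp : ∀ d, MemLp (fun p : (Fin D → ℝ) × ℝ => p.1 d) 2 R.paramDist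
  /-- the coefficients in the `D` coordinates are drawn independently -/
  coeff_indep : iIndepFun (fun (d : Fin D) (p : (Fin D → ℝ) × ℝ) => p.1 d) R.paramDist
  /-- the noise level has finite expectation -/
  noise_integrable : Integrable (fun p : (Fin D → ℝ) × ℝ => p.2) R.paramDist
  /-- the inputs have finite second moments -/
  input_memLp : ∀ i d, MemLp (fun x : Fin D → ℝ => x d) 2 (R.inputDist i)
  /-- the matrix `X_iᵀ X_i` is almost surely invertible -/
  gram_isUnit : ∀ i, ∀ᵐ X ∂(R.designLaw i), IsUnit (gram (Matrix.of X))
  /-- a label at the input `x` has finite second moment, mean `x · θ` and variance `ε` -/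
  label : ∀ i, ∀ᵐ q ∂(R.paramDist.prod (R.inputDist i)),
    MemLp id 2 (R.labelDist i (q.2 ⬝ᵥ q.1.1, q.1.2)) ∧
    ∫ y, y ∂(R.labelDist i (q.2 ⬝ᵥ q.1.1, q.1.2)) = q.2 ⬝ᵥ q.1.1 ∧
    variance id (R.labelDist i (q.2 ⬝ᵥ q.1.1, q.1.2)) = q.1.2

/-- `μ_e`, the expectation of the noise level. -/
def meanNoise : ℝ := ∫ p, p.2 ∂(R.paramDist)

/-- `σ_d²`, the variance of the `d`-th coefficient. -/
def coeffVar (d : Fin D) : ℝ := variance (fun p : (Fin D → ℝ) × ℝ => p.1 d) R.paramDist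

/-- `Σ_i = E[x xᵀ]`, the second-moment matrix of the input distribution of player `i`. -/
def secondMoment (i : Fin M) : Matrix (Fin D) (Fin D) ℝ :=
  Matrix.of fun a b => ∫ x, x a * x b ∂(R.inputDist i)

/-- All entries of `(X_iᵀ X_i)⁻¹` are integrable. -/
def InvGramIntegrable (i : Fin M) : Prop :=
  ∀ a b, Integrable (fun X => (gram (Matrix.of X))⁻¹ a b) (R.designLaw i)

/-- `E[(X_iᵀ X_i)⁻¹]`, entry by entry. -/
def expInvGram (i : Fin M) : Matrix (Fin D) (Fin D) ℝ :=
  Matrix.of fun a b => ∫ X, (gram (Matrix.of X))⁻¹ a b ∂(R.designLaw i)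

/-- One labelled sample `(x, y)` of player `i` given its parameters `(θ, ε)`: the input `x` is
drawn from the input distribution, then the label `y` from the label law with mean `x · θ` and
noise level `ε`. -/
def sampleKernel (i : Fin M) : Kernel ((Fin D → ℝ) × ℝ) ((Fin D → ℝ) × ℝ) :=
  (Kernel.const _ (R.inputDist i)) ⊗ₖ
    ((R.labelDist i).comap
      (fun q : ((Fin D → ℝ) × ℝ) × (Fin D → ℝ) => (q.2 ⬝ᵥ q.1.1, q.1.2))
      (by unfold dotProduct; fun_prop))

instance (i : Fin M) : IsMarkovKernel (R.sampleKernel i) := by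
  unfold sampleKernel; infer_instance

/-- The parameters of player `i` together with its labelled data set. -/
abbrev PlayerData (i : Fin M) : Type :=
  ((Fin D → ℝ) × ℝ) × (Fin (R.n i) → (Fin D → ℝ) × ℝ)

/-- The joint law of the parameters and of the data set of player `i`. -/
def playerLaw (i : Fin M) : Measure (R.PlayerData i) :=
  R.paramDist ⊗ₘ (iidKernel (R.sampleKernel i) (R.n i))

instance (i : Fin M) : IsProbabilityMeasure (R.playerLaw i) := by
  have : IsMarkovKernel (iidKernel (R.sampleKernel i) (R.n i)) :=
    ⟨fun a => inferInstanceAs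
      (IsProbabilityMeasure (Measure.pi fun _ : Fin (R.n i) => R.sampleKernel i a))⟩
  unfold playerLaw; infer_instance

/-- The joint law of everything that is random in the error of player `j`: the players draw
their parameters and data independently, and a test point is drawn from the input distribution
of player `j`. -/
def jointLaw (j : Fin M) : Measure ((∀ i, R.PlayerData i) × (Fin D → ℝ)) :=
  (Measure.pi R.playerLaw).prod (R.inputDist j)

/-- The ordinary least squares estimate `(Xᵀ X)⁻¹ Xᵀ Y` from labelled data `(x_l, y_l)`. -/
def ols {n : ℕ} (z : Fin n → (Fin D → ℝ) × ℝ) : Fin D → ℝ :=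
  let X : Matrix (Fin n) (Fin D) ℝ := Matrix.of fun l => (z l).1
  let Y : Fin n → ℝ := fun l => (z l).2
  (gram X)⁻¹ *ᵥ (Xᵀ *ᵥ Y)

/-- Fine-grained federation: the weighted combination of the local estimates of all players. -/
def fineGrained (v : Fin M → ℝ) (ω : ∀ i, R.PlayerData i) : Fin D → ℝ :=
  ∑ i, v i • ols (ω i).2

/-- The squared error of player `j` at the test point: `(xᵀ θ̂_j^v - xᵀ θ_j)²`. -/
def sqError (v : Fin M → ℝ) (j : Fin M) (ω : (∀ i, R.PlayerData i) × (Fin D → ℝ)) : ℝ :=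
  (ω.2 ⬝ᵥ R.fineGrained v ω.1 - ω.2 ⬝ᵥ (ω.1 j).1.1) ^ 2

/-- The expected mean squared error of player `j` under fine-grained federation. -/
def expectedMSE (v : Fin M → ℝ) (j : Fin M) : ℝ :=
  ∫ ω, R.sqError v j ω ∂(R.jointLaw j)

/-- The variance term `L_j = μ_e ∑_i v_i² tr(Σ_j E[(X_iᵀ X_i)⁻¹])`. -/
def varianceTerm (v : Fin M → ℝ) (j : Fin M) : ℝ :=
  R.meanNoise * ∑ i, v i ^ 2 * (R.secondMoment j * R.expInvGram i).trace

end RegressionModel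

/-! ### Mean estimation -/

/-- The data of the federated mean estimation problem with `M` players. -/
structure MeanModel (M : ℕ) where
  /-- number of samples of each player -/
  n : Fin M → ℕ
  /-- the common law of the parameters `(θ_i, ε_i)` (true mean, noise level) of a player -/
  paramDist : Measure (ℝ × ℝ)
  /-- `sampleDist i (m, e)` is the law of a sample of player `i` with mean `m` and noise
  level `e` -/
  sampleDist : Fin M → Kernel (ℝ × ℝ) ℝ
  isProb_param : IsProbabilityMeasure paramDist
  isMarkov_sample : ∀ i, IsMarkovKernel (sampleDist i)

namespace MeanModel

attribute [instance] isProb_param isMarkov_sample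

variable {M : ℕ} (R : MeanModel M)

/-- The assumptions of the model. -/
structure Standing : Prop where
  /-- every player has at least one sample -/
  n_pos : ∀ i, 0 < R.n i
  /-- the true mean has finite second moment -/
  mean_memLp : MemLp (fun p : ℝ × ℝ => p.1) 2 R.paramDist
  /-- the noise level has finite expectation -/
  noise_integrable : Integrable (fun p : ℝ × ℝ => p.2) R.paramDist
  /-- a sample has finite second moment, mean `θ` and variance `ε` -/
  sample : ∀ i, ∀ᵐ p ∂(R.paramDist),
    MemLp id 2 (R.sampleDist i p) ∧
    ∫ y, y ∂(R.sampleDist i p) = p.1 ∧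
    variance id (R.sampleDist i p) = p.2

/-- `μ_e`, the expectation of the noise level. -/
def meanNoise : ℝ := ∫ p, p.2 ∂(R.paramDist)

/-- `σ²`, the variance of the true mean. -/
def meanVar : ℝ := variance (fun p : ℝ × ℝ => p.1) R.paramDist

/-- The parameters of player `i` together with its samples. -/
abbrev PlayerData (i : Fin M) : Type := (ℝ × ℝ) × (Fin (R.n i) → ℝ)

/-- The joint law of the parameters and of the samples of player `i`. -/
def playerLaw (i : Fin M) : Measure (R.PlayerData i) :=
  R.paramDist ⊗ₘ (iidKernel (R.sampleDist i) (R.n i))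

instance (i : Fin M) : IsProbabilityMeasure (R.playerLaw i) := by
  have : IsMarkovKernel (iidKernel (R.sampleDist i) (R.n i)) :=
    ⟨fun a => inferInstanceAs
      (IsProbabilityMeasure (Measure.pi fun _ : Fin (R.n i) => R.sampleDist i a))⟩
  unfold playerLaw; infer_instance

/-- The local estimate: the sample mean. -/
def sampleMean {n : ℕ} (y : Fin n → ℝ) : ℝ := (∑ l, y l) / n

/-- The squared error `(θ̂_j^v - θ_j)²` of player `j` under fine-grained federation. -/
def sqError (v : Fin M → ℝ) (j : Fin M) (ω : ∀ i, R.PlayerData i) : ℝ :=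
  ((∑ i, v i * sampleMean (ω i).2) - (ω j).1.1) ^ 2

/-- The expected mean squared error of player `j` under fine-grained federation. -/
def expectedMSE (v : Fin M → ℝ) (j : Fin M) : ℝ :=
  ∫ ω, R.sqError v j ω ∂(Measure.pi R.playerLaw)

end MeanModel

end Federation

end

/-! Let `μ` be the common mean of the parameters and `δ` the Kronecker symbol. As the weights sum to
one, the coefficients `v_i - δ_ij` sum to zero, and so the error of player `j` is `∑_i [v_i (θ̂_i -
θ_i) + (v_i - δ_ij)(θ_i - μ)]`. The summands belong to different players, hence are independent, and
they are centred, so their second moments add up without cross terms.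

Within one player, `θ̂_i - θ_i = P (Y - Xθ)` with `P = (XᵀX)⁻¹Xᵀ`. Given parameters and inputs this
is a linear combination of independent centred noises, so it is orthogonal to every function of the
parameters, and its conditional covariance is `ε P Pᵀ = ε (XᵀX)⁻¹`. Noise level and inputs are
independent, which gives `μ_e E[(XᵀX)⁻¹]`; the squares `(v_i - δ_ij)²` sum to `biasWeight`. Pairing
the covariance matrix of the error with the second moments of the independent test point gives (a).
Mean estimation is the scalar case, with `1/n` in place of `P`.

For (b), write `X = Z Sᵀ` with `Z` standard normal and `S Sᵀ = Σ`. This reduces the claim to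
`E[(ZᵀZ)⁻¹] = (n - D - 1)⁻¹ I`. Off-diagonal entries vanish by symmetry under changing the sign of a
column (`gram_inv_flipColumn`). A diagonal entry is the inverse squared distance of a column from
the span of the other `D - 1` (`gram_inv_apply_self`). That column is independent of the others, and
its projection onto their orthogonal complement is standard normal in dimension `m = n - D + 1`. The
entry is therefore an inverse `χ²_m` variable, whose mean is `1/(m - 2)`. -/

namespace Federation

/-! ### Second moments of sums of independent variables -/

section Independent

variable {ι : Type*} [Fintype ι] {Ω : ι → Type*} [∀ i, MeasurableSpace (Ω i)]
  {μ : ∀ i, Measure (Ω i)} [∀ i, IsProbabilityMeasure (μ i)]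

lemma memLp_two_sum_pi {f : ∀ i, Ω i → ℝ} (hf : ∀ i, MemLp (f i) 2 (μ i)) :
    MemLp (fun ω : ∀ i, Ω i => ∑ i, f i (ω i)) 2 (Measure.pi μ) :=
  memLp_finsetSum _ fun i _ => (hf i).comp_measurePreserving (measurePreserving_eval μ i)

lemma integral_sum_pi {f : ∀ i, Ω i → ℝ} (hf : ∀ i, Integrable (f i) (μ i)) :
    ∫ ω, ∑ i, f i (ω i) ∂(Measure.pi μ) = ∑ i, ∫ x, f i x ∂(μ i) := by
  rw [integral_finsetSum _ fun i _ => integrable_comp_eval (hf i)]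
  exact Finset.sum_congr rfl fun i _ => integral_comp_eval (hf i).1

/-- The second moments of sums of independent centred random variables add up. -/
lemma integral_sum_mul_sum_pi {f g : ∀ i, Ω i → ℝ} (hf : ∀ i, MemLp (f i) 2 (μ i))
    (hg : ∀ i, MemLp (g i) 2 (μ i)) (hf0 : ∀ i, ∫ x, f i x ∂(μ i) = 0) :
    ∫ ω, (∑ i, f i (ω i)) * (∑ i, g i (ω i)) ∂(Measure.pi μ)
      = ∑ i, ∫ x, f i x * g i x ∂(μ i) := by
  classical
  have hF : ∀ i, MemLp (fun ω : ∀ i, Ω i => f i (ω i)) 2 (Measure.pi μ) :=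
    fun i => (hf i).comp_measurePreserving (measurePreserving_eval μ i)
  have hG : ∀ i, MemLp (fun ω : ∀ i, Ω i => g i (ω i)) 2 (Measure.pi μ) :=
    fun i => (hg i).comp_measurePreserving (measurePreserving_eval μ i)
  have hint : ∀ i k, Integrable (fun ω : ∀ i, Ω i => f i (ω i) * g k (ω k)) (Measure.pi μ) :=
    fun i k => (hF i).integrable_mul (hG k)
  have hmul : ∀ i k, ∫ ω : ∀ i, Ω i, f i (ω i) * g k (ω k) ∂(Measure.pi μ)
      = if i = k then ∫ x, f i x * g i x ∂(μ i) else 0 := by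
    intro i k
    split_ifs with h
    · subst h
      exact integral_comp_eval (f := fun x => f i x * g i x)
        ((hf i).1.mul (hg i).1)
    -- For `i ≠ k` the two factors are independent, so it is enough that one of them is centred.
    · have hid : iIndepFun (fun i (ω : ∀ i, Ω i) => ω i) (Measure.pi μ) :=
        iIndepFun_pi (X := fun i (x : Ω i) => x) fun i => aemeasurable_id
      have hind := (hid.indepFun h).comp₀ (φ := f i) (ψ := g k)
        (measurable_pi_apply i).aemeasurable (measurable_pi_apply k).aemeasurable
        (by rw [(measurePreserving_eval μ i).map_eq]; exact (hf i).1.aemeasurable)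
        (by rw [(measurePreserving_eval μ k).map_eq]; exact (hg k).1.aemeasurable)
      have := hind.integral_mul_eq_mul_integral (hF i).1 (hG k).1
      refine Eq.trans this ?_
      have h0 : ∫ ω : ∀ i, Ω i, f i (ω i) ∂(Measure.pi μ) = 0 := by
        rw [integral_comp_eval (hf i).1, hf0 i]
      change (∫ ω : ∀ i, Ω i, f i (ω i) ∂(Measure.pi μ)) * _ = 0
      rw [h0, zero_mul]
  simp_rw [Finset.sum_mul_sum]
  rw [integral_finsetSum _ fun i _ => integrable_finsetSum _ fun k _ => hint i k]
  refine Finset.sum_congr rfl fun i _ => ?_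
  rw [integral_finsetSum _ fun k _ => hint i k]
  simp [hmul]

end Independent

/-! ### Independent samples given a common value -/

section PiKernel

variable {α β : Type*} [MeasurableSpace α] [MeasurableSpace β] {n : ℕ}

/-- Given the value `a`, draw independent samples from the probability measures `κ l a`. -/
noncomputable def piKernel (κ : Fin n → Kernel α β) [∀ l, IsMarkovKernel (κ l)] : Kernel α (Fin n → β) where
  toFun a := Measure.pi fun l : Fin n => κ l a
  measurable' := by
    apply Measurable.measure_of_isPiSystem_of_isProbabilityMeasure
      (generateFrom_pi (α := fun _ : Fin n => β)).symm isPiSystem_pi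
    rintro _ ⟨s, hs, rfl⟩
    simp only [Measure.pi_pi]
    exact Finset.measurable_prod _ fun l _ =>
      Kernel.measurable_coe (κ l) (hs l (Set.mem_univ l))

lemma piKernel_apply (κ : Fin n → Kernel α β) [∀ l, IsMarkovKernel (κ l)] (a : α) :
    piKernel κ a = Measure.pi fun l => κ l a := rfl

instance (κ : Fin n → Kernel α β) [∀ l, IsMarkovKernel (κ l)] : IsMarkovKernel (piKernel κ) :=
  ⟨fun a => inferInstanceAs (IsProbabilityMeasure (Measure.pi fun l => κ l a))⟩

/-- Drawing `n` pairs `(x, y)` amounts to drawing first all `x`, then all `y`. -/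
lemma map_compProd_piKernel_eq_pi (ν : Measure α) [IsProbabilityMeasure ν] (κ : Kernel α β)
    [IsMarkovKernel κ] :
    ((Measure.pi fun _ : Fin n => ν) ⊗ₘ
        piKernel fun l => κ.comap (fun x : Fin n → α => x l) (measurable_pi_apply l)).map
      (fun q l => (q.1 l, q.2 l)) = Measure.pi fun _ : Fin n => ν ⊗ₘ κ := by
  refine (Measure.pi_eq fun s hs => ?_).symm
  have hm : Measurable fun (q : (Fin n → α) × (Fin n → β)) (l : Fin n) => (q.1 l, q.2 l) := by
    fun_prop
  rw [Measure.map_apply hm (MeasurableSet.univ_pi hs),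
    Measure.compProd_apply (hm (MeasurableSet.univ_pi hs))]
  -- A section of a box is again a box, so its conditional measure is a product of functions of the
  -- separate coordinates `x l`, and the integral factors.
  have hsec : ∀ x : Fin n → α, (piKernel fun l => κ.comap (fun x : Fin n → α => x l)
      (measurable_pi_apply l)) x (Prod.mk x ⁻¹'
        ((fun (q : (Fin n → α) × (Fin n → β)) (l : Fin n) => (q.1 l, q.2 l)) ⁻¹'
          Set.univ.pi s)) = ∏ l, κ (x l) (Prod.mk (x l) ⁻¹' s l) := by
    intro x
    rw [piKernel_apply, ← Measure.pi_pi]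
    congr 1
  simp_rw [hsec]
  have hme : ∀ l, Measurable fun a => κ a (Prod.mk a ⁻¹' s l) :=
    fun l => Kernel.measurable_kernel_prodMk_left (hs l)
  rw [lintegral_prod_eq_prod_lintegral_of_indepFun Finset.univ
    (fun l (x : Fin n → α) => κ (x l) (Prod.mk (x l) ⁻¹' s l))
    (iIndepFun_pi fun l => (hme l).aemeasurable)
    (fun l => (hme l).comp (measurable_pi_apply l))]
  refine Finset.prod_congr rfl fun l _ => ?_
  rw [Measure.compProd_apply (hs l)]
  exact (measurePreserving_eval (fun _ : Fin n => ν) l).lintegral_comp (hme l)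

end PiKernel

/-! ### Conditionally centred noise -/

section Noise

variable {B : Type*} [MeasurableSpace B] {n : ℕ}

/-- The combination `∑ c_l (y_l - m_l)` of the deviations of the samples from their means. -/
def noise (m c : Fin n → B → ℝ) (q : B × (Fin n → ℝ)) : ℝ :=
  ∑ l, c l q.1 * (q.2 l - m l q.1)

lemma measurable_noise {m c : Fin n → B → ℝ} (hm : ∀ l, Measurable (m l))
    (hc : ∀ l, Measurable (c l)) : Measurable (noise m c) := by
  unfold noise
  refine Finset.measurable_sum _ fun l _ => ?_
  have := hm l
  have := hc l
  fun_prop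

variable (κ : Fin n → Kernel B ℝ) [∀ l, IsMarkovKernel (κ l)] {m c d : Fin n → B → ℝ} {e : B → ℝ}

/-- The samples have means `m_l` and common variance `e`, given the value `b`. -/
def HasMeanVar (m : Fin n → B → ℝ) (e : B → ℝ) (b : B) : Prop :=
  ∀ l, MemLp id 2 (κ l b) ∧ ∫ y, y ∂(κ l b) = m l b ∧ variance id (κ l b) = e b

variable {κ}

lemma HasMeanVar.memLp {b : B} (h : HasMeanVar κ m e b) (l : Fin n) :
    MemLp (fun y => c l b * (y - m l b)) 2 (κ l b) :=
  (((h l).1.sub (memLp_const (m l b))).const_mul (c l b))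

lemma HasMeanVar.integral_eq_zero {b : B} (h : HasMeanVar κ m e b) (l : Fin n) :
    ∫ y, c l b * (y - m l b) ∂(κ l b) = 0 := by
  rw [integral_const_mul, integral_sub (f := fun y => y)
    ((h l).1.integrable one_le_two) (integrable_const _)]
  simp [(h l).2.1]

lemma HasMeanVar.memLp_noise {b : B} (h : HasMeanVar κ m e b) :
    MemLp (fun y => noise m c (b, y)) 2 (piKernel κ b) :=
  memLp_two_sum_pi (μ := fun l => κ l b) fun l => h.memLp l

lemma HasMeanVar.integral_noise {b : B} (h : HasMeanVar κ m e b) :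
    ∫ y, noise m c (b, y) ∂(piKernel κ b) = 0 := by
  refine (integral_sum_pi (μ := fun l => κ l b) (f := fun l y => c l b * (y - m l b))
    fun l => (h.memLp l).integrable one_le_two).trans ?_
  exact Finset.sum_eq_zero fun l _ => h.integral_eq_zero l

lemma HasMeanVar.integral_noise_mul_noise {b : B} (h : HasMeanVar κ m e b) :
    ∫ y, noise m c (b, y) * noise m d (b, y) ∂(piKernel κ b) = e b * ∑ l, c l b * d l b := by
  refine (integral_sum_mul_sum_pi (μ := fun l => κ l b) (f := fun l y => c l b * (y - m l b))
    (g := fun l y => d l b * (y - m l b)) (fun l => h.memLp l) (fun l => h.memLp l)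
    fun l => h.integral_eq_zero l).trans ?_
  rw [Finset.mul_sum]
  refine Finset.sum_congr rfl fun l _ => ?_
  have hv : ∫ y, (y - m l b) ^ 2 ∂(κ l b) = e b := by
    rw [← (h l).2.2, variance_eq_integral aemeasurable_id]
    simp [(h l).2.1]
  calc ∫ y, c l b * (y - m l b) * (d l b * (y - m l b)) ∂(κ l b)
      = ∫ y, (c l b * d l b) * (y - m l b) ^ 2 ∂(κ l b) := by congr 1; ext y; ring
    _ = e b * (c l b * d l b) := by rw [integral_const_mul, hv, mul_comm]

variable {ρ : Measure B} [IsProbabilityMeasure ρ]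

/-- By Tonelli, square integrability only needs the conditional second moment `e ∑ c_l²` to be
integrable over the base. -/
lemma memLp_noise (h : ∀ᵐ b ∂ρ, HasMeanVar κ m e b) (hm : ∀ l, Measurable (m l))
    (hc : ∀ l, Measurable (c l)) (hce : Integrable (fun b => e b * ∑ l, c l b * c l b) ρ) :
    MemLp (noise m c) 2 (ρ ⊗ₘ piKernel κ) := by
  have hms := (measurable_noise hm hc)
  rw [memLp_two_iff_integrable_sq hms.aestronglyMeasurable,
    Measure.integrable_compProd_iff (hms.pow_const 2).aestronglyMeasurable]
  constructor
  · filter_upwards [h] with b hb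
    exact hb.memLp_noise.integrable_sq
  · refine hce.congr ?_
    filter_upwards [h] with b hb
    rw [← hb.integral_noise_mul_noise]
    congr 1
    ext y
    rw [Real.norm_of_nonneg (sq_nonneg _), sq]

lemma integral_noise_mul_noise (h : ∀ᵐ b ∂ρ, HasMeanVar κ m e b) (hm : ∀ l, Measurable (m l))
    (hc : ∀ l, Measurable (c l)) (hd : ∀ l, Measurable (d l))
    (hce : Integrable (fun b => e b * ∑ l, c l b * c l b) ρ)
    (hde : Integrable (fun b => e b * ∑ l, d l b * d l b) ρ) :
    ∫ q, noise m c q * noise m d q ∂(ρ ⊗ₘ piKernel κ) = ∫ b, e b * ∑ l, c l b * d l b ∂ρ := by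
  refine (Measure.integral_compProd
    ((memLp_noise h hm hc hce).integrable_mul (memLp_noise h hm hd hde))).trans ?_
  refine integral_congr_ae ?_
  filter_upwards [h] with b hb
  exact hb.integral_noise_mul_noise

lemma memLp_comp_fst_compProd {g : B → ℝ} (hg : MemLp g 2 ρ) :
    MemLp (fun q : B × (Fin n → ℝ) => g q.1) 2 (ρ ⊗ₘ piKernel κ) :=
  hg.comp_measurePreserving ⟨measurable_fst, Measure.fst_compProd ρ (piKernel κ)⟩

/-- The conditional mean of the noise given `b` is zero. This removes the cross terms between
estimation error and parameter deviation. -/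
lemma integral_noise_mul_fst (h : ∀ᵐ b ∂ρ, HasMeanVar κ m e b) (hm : ∀ l, Measurable (m l))
    (hc : ∀ l, Measurable (c l)) (hce : Integrable (fun b => e b * ∑ l, c l b * c l b) ρ)
    {g : B → ℝ} (hg : MemLp g 2 ρ) :
    ∫ q, noise m c q * g q.1 ∂(ρ ⊗ₘ piKernel κ) = 0 := by
  refine (Measure.integral_compProd
    ((memLp_noise h hm hc hce).integrable_mul (memLp_comp_fst_compProd hg))).trans ?_
  rw [← integral_zero B ℝ]
  refine integral_congr_ae ?_
  filter_upwards [h] with b hb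
  change ∫ y, noise m c (b, y) * g b ∂(piKernel κ b) = 0
  rw [integral_mul_const, hb.integral_noise, zero_mul]

end Noise

/-- The term at `j` is `v_j - 1 = -∑_{i ≠ j} v_i`, whose square is the second part of `biasWeight`.
-/
lemma sum_sq_sub_indicator_eq_biasWeight {M : ℕ} {v : Fin M → ℝ} (hv : ∑ i, v i = 1) (j : Fin M) :
    ∑ i, (v i - if i = j then 1 else 0) ^ 2 = biasWeight v j := by
  rw [← Finset.add_sum_erase _ _ (Finset.mem_univ j)] at hv ⊢
  have hj : v j - 1 = -∑ i ∈ Finset.univ.erase j, v i := by linarith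
  have : ∀ i ∈ Finset.univ.erase j, (v i - if i = j then 1 else 0) ^ 2 = v i ^ 2 := by
    intro i hi
    rw [if_neg (Finset.ne_of_mem_erase hi), sub_zero]
  rw [Finset.sum_congr rfl this, if_pos rfl, hj, biasWeight]
  ring

/-! ### Moments of the contribution of one player -/

section PlayerError

variable {B : Type*} [MeasurableSpace B] {n : ℕ} {κ : Fin n → Kernel B ℝ}
  [∀ l, IsMarkovKernel (κ l)] {m c d : Fin n → B → ℝ} {e : B → ℝ}
  {ρ : Measure B} [IsProbabilityMeasure ρ]

/-- An error that combines the noise of the samples with a deviation of the parameters. -/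
def noiseAdd (α β : ℝ) (m c : Fin n → B → ℝ) (g : B → ℝ) (q : B × (Fin n → ℝ)) : ℝ :=
  α * noise m c q + β * g q.1

lemma memLp_noiseAdd (h : ∀ᵐ b ∂ρ, HasMeanVar κ m e b) (hm : ∀ l, Measurable (m l))
    (hc : ∀ l, Measurable (c l)) (hce : Integrable (fun b => e b * ∑ l, c l b * c l b) ρ)
    {g : B → ℝ} (hg : MemLp g 2 ρ) (α β : ℝ) :
    MemLp (noiseAdd α β m c g) 2 (ρ ⊗ₘ piKernel κ) :=
  ((memLp_noise h hm hc hce).const_mul α).add ((memLp_comp_fst_compProd hg).const_mul β)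

lemma integral_comp_fst_compProd {g : B → ℝ} (hg : AEStronglyMeasurable g ρ) :
    ∫ q, g q.1 ∂(ρ ⊗ₘ piKernel κ) = ∫ b, g b ∂ρ := by
  have hfst : (ρ ⊗ₘ piKernel κ).map Prod.fst = ρ := Measure.fst_compProd ρ (piKernel κ)
  conv_rhs => rw [← hfst]
  rw [integral_map measurable_fst.aemeasurable (by rwa [hfst])]

lemma integral_noiseAdd (h : ∀ᵐ b ∂ρ, HasMeanVar κ m e b) (hm : ∀ l, Measurable (m l))
    (hc : ∀ l, Measurable (c l)) (hce : Integrable (fun b => e b * ∑ l, c l b * c l b) ρ)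
    {g : B → ℝ} (hg : MemLp g 2 ρ) (hg0 : ∫ b, g b ∂ρ = 0) (α β : ℝ) :
    ∫ q, noiseAdd α β m c g q ∂(ρ ⊗ₘ piKernel κ) = 0 := by
  -- Orthogonality to the constant `1` says that the noise is centred.
  have h1 := integral_noise_mul_fst h hm hc hce (memLp_const (1 : ℝ))
  have h2 : ∫ q, g q.1 ∂(ρ ⊗ₘ piKernel κ) = 0 := by
    rw [integral_comp_fst_compProd hg.1, hg0]
  simp only [mul_one] at h1
  unfold noiseAdd
  rw [integral_add (((memLp_noise h hm hc hce).const_mul α).integrable one_le_two)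
    (((memLp_comp_fst_compProd hg).const_mul β).integrable one_le_two),
    integral_const_mul, integral_const_mul, h1, h2]
  simp

lemma integral_noiseAdd_mul_noiseAdd (h : ∀ᵐ b ∂ρ, HasMeanVar κ m e b)
    (hm : ∀ l, Measurable (m l)) (hc : ∀ l, Measurable (c l)) (hd : ∀ l, Measurable (d l))
    (hce : Integrable (fun b => e b * ∑ l, c l b * c l b) ρ)
    (hde : Integrable (fun b => e b * ∑ l, d l b * d l b) ρ)
    {f g : B → ℝ} (hf : MemLp f 2 ρ) (hg : MemLp g 2 ρ) (α β : ℝ) :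
    ∫ q, noiseAdd α β m c f q * noiseAdd α β m d g q ∂(ρ ⊗ₘ piKernel κ)
      = α ^ 2 * ∫ b, e b * ∑ l, c l b * d l b ∂ρ + β ^ 2 * ∫ b, f b * g b ∂ρ := by
  have hnc := memLp_noise h hm hc hce
  have hnd := memLp_noise h hm hd hde
  have hf' : MemLp (fun q : B × (Fin n → ℝ) => f q.1) 2 (ρ ⊗ₘ piKernel κ) :=
    memLp_comp_fst_compProd hf
  have hg' : MemLp (fun q : B × (Fin n → ℝ) => g q.1) 2 (ρ ⊗ₘ piKernel κ) :=
    memLp_comp_fst_compProd hg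
  have i1 : Integrable (fun q => noise m c q * noise m d q) (ρ ⊗ₘ piKernel κ) :=
    hnc.integrable_mul hnd
  have i2 : Integrable (fun q => noise m c q * g q.1) (ρ ⊗ₘ piKernel κ) :=
    hnc.integrable_mul hg'
  have i3 : Integrable (fun q => noise m d q * f q.1) (ρ ⊗ₘ piKernel κ) :=
    hnd.integrable_mul hf'
  have i4 : Integrable (fun q => f q.1 * g q.1) (ρ ⊗ₘ piKernel κ) := hf'.integrable_mul hg'
  have e4 : ∫ q, f q.1 * g q.1 ∂(ρ ⊗ₘ piKernel κ) = ∫ b, f b * g b ∂ρ :=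
    integral_comp_fst_compProd (g := fun b => f b * g b) (hf.1.mul hg.1)
  have hexp : ∀ q, noiseAdd α β m c f q * noiseAdd α β m d g q
      = (α ^ 2 * (noise m c q * noise m d q) + α * β * (noise m c q * g q.1))
        + (α * β * (noise m d q * f q.1) + β ^ 2 * (f q.1 * g q.1)) := by
    intro q
    unfold noiseAdd
    ring
  simp_rw [hexp]
  have j1 : Integrable (fun q => α ^ 2 * (noise m c q * noise m d q)
      + α * β * (noise m c q * g q.1)) (ρ ⊗ₘ piKernel κ) := (i1.const_mul _).add (i2.const_mul _)
  have j2 : Integrable (fun q => α * β * (noise m d q * f q.1) + β ^ 2 * (f q.1 * g q.1))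
      (ρ ⊗ₘ piKernel κ) := (i3.const_mul _).add (i4.const_mul _)
  rw [integral_add j1 j2,
    integral_add (i1.const_mul _) (i2.const_mul _), integral_add (i3.const_mul _) (i4.const_mul _)]
  simp only [integral_const_mul]
  rw [integral_noise_mul_noise h hm hc hd hce hde, integral_noise_mul_fst h hm hc hce hg,
    integral_noise_mul_fst h hm hd hde hf, e4]
  ring

end PlayerError

lemma memLp_sub_integral {Ω : Type*} [MeasurableSpace Ω] {μ : Measure Ω} [IsProbabilityMeasure μ]
    {f : Ω → ℝ} (hf : MemLp f 2 μ) : MemLp (fun ω => f ω - ∫ x, f x ∂μ) 2 μ :=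
  hf.sub (memLp_const _)

lemma integral_sub_integral {Ω : Type*} [MeasurableSpace Ω] {μ : Measure Ω}
    [IsProbabilityMeasure μ] {f : Ω → ℝ} (hf : MemLp f 2 μ) :
    ∫ ω, (f ω - ∫ x, f x ∂μ) ∂μ = 0 := by
  rw [integral_sub (hf.integrable one_le_two) (integrable_const _)]
  simp

/-! ### Mean estimation -/

namespace MeanModel

variable {M : ℕ} {R : MeanModel M}

lemma Standing.hasMeanVar (hR : R.Standing) (i : Fin M) :
    ∀ᵐ p ∂(R.paramDist), HasMeanVar (fun _ : Fin (R.n i) => R.sampleDist i)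
      (fun _ p => p.1) (fun p => p.2) p := by
  filter_upwards [hR.sample i] with p hp _ using hp

theorem Standing.integrable_sqError_and_expectedMSE_eq (hR : R.Standing) (j : Fin M)
    {v : Fin M → ℝ} (hv : ∑ i, v i = 1) :
    Integrable (R.sqError v j) (Measure.pi R.playerLaw) ∧
      R.expectedMSE v j = R.meanNoise * ∑ i, v i ^ 2 * (1 / (R.n i : ℝ)) +
        biasWeight v j * R.meanVar := by
  set μ := ∫ p, p.1 ∂(R.paramDist)
  let W : ∀ i, R.PlayerData i → ℝ := fun i =>
    noiseAdd (v i) (v i - if i = j then 1 else 0) (fun _ p => p.1)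
      (fun _ _ => (R.n i : ℝ)⁻¹) (fun p => p.1 - μ)
  have hn : ∀ i, (R.n i : ℝ) ≠ 0 := fun i => Nat.cast_ne_zero.2 (hR.n_pos i).ne'
  have hce : ∀ i, Integrable
      (fun p : ℝ × ℝ => p.2 * ∑ _l : Fin (R.n i), (R.n i : ℝ)⁻¹ * (R.n i : ℝ)⁻¹) R.paramDist :=
    fun i => hR.noise_integrable.mul_const _
  have hg := memLp_sub_integral hR.mean_memLp
  have hWL : ∀ i, MemLp (W i) 2 (R.playerLaw i) := fun i =>
    memLp_noiseAdd (hR.hasMeanVar i) (fun _ => measurable_fst) (fun _ => measurable_const)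
      (hce i) hg _ _
  have hW0 : ∀ i, ∫ ω, W i ω ∂(R.playerLaw i) = 0 := fun i =>
    integral_noiseAdd (hR.hasMeanVar i) (fun _ => measurable_fst) (fun _ => measurable_const)
      (hce i) hg (integral_sub_integral hR.mean_memLp) _ _
  have hW2 : ∀ i, ∫ ω, W i ω * W i ω ∂(R.playerLaw i)
      = v i ^ 2 * (R.meanNoise * (1 / (R.n i : ℝ)))
        + (v i - if i = j then 1 else 0) ^ 2 * R.meanVar := by
    intro i
    refine (integral_noiseAdd_mul_noiseAdd (hR.hasMeanVar i) (fun _ => measurable_fst)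
      (fun _ => measurable_const) (fun _ => measurable_const) (hce i) (hce i) hg hg _ _).trans ?_
    congr 2
    · rw [integral_mul_const, meanNoise]
      congr 1
      have := hn i
      simp
      field_simp
    · rw [meanVar, variance_eq_integral measurable_fst.aemeasurable]
      simp_rw [sq]
  have hsq : R.sqError v j = fun ω => (∑ i, W i (ω i)) * ∑ i, W i (ω i) := by
    funext ω
    rw [sqError, sq]
    have : (∑ i, v i * sampleMean (ω i).2) - (ω j).1.1 = ∑ i, W i (ω i) := by
      -- In the sum over `i`, the terms `v i * μ` add up to `μ` and the indicator selects `θ_j - μ`;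
      -- together they give `θ_j`.
      have hWi : ∀ i, W i (ω i) = v i * sampleMean (ω i).2
          - (v i * μ + ((ω i).1.1 - μ) * if i = j then 1 else 0) := by
        intro i
        have : noise (fun (_ : Fin (R.n i)) (p : ℝ × ℝ) => p.1) (fun _ _ => (R.n i : ℝ)⁻¹) (ω i)
            = sampleMean (ω i).2 - (ω i).1.1 := by
          have := hn i
          simp only [noise, sampleMean, ← Finset.mul_sum, Finset.sum_sub_distrib]
          simp
          field_simp
        simp only [W, noiseAdd, this]
        ring
      simp_rw [hWi, Finset.sum_sub_distrib, Finset.sum_add_distrib, ← Finset.sum_mul, hv]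
      simp
    rw [this]
  constructor
  · rw [hsq]
    exact (memLp_two_sum_pi hWL).integrable_mul (memLp_two_sum_pi hWL)
  · rw [expectedMSE, hsq, integral_sum_mul_sum_pi hWL hWL hW0]
    simp_rw [hW2]
    rw [Finset.sum_add_distrib, ← Finset.sum_mul, sum_sq_sub_indicator_eq_biasWeight hv,
      Finset.mul_sum]
    congr 1
    exact Finset.sum_congr rfl fun i _ => by ring

end MeanModel

/-! ### Least squares, and the law of the data with inputs drawn before labels -/

namespace RegressionModel

variable {M D : ℕ} {n : ℕ}

/-- The pseudo-inverse `(Xᵀ X)⁻¹ Xᵀ` of the matrix with rows `X l`. -/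
noncomputable def pseudoInv (X : Fin n → Fin D → ℝ) : Matrix (Fin D) (Fin n) ℝ :=
  (gram (Matrix.of X))⁻¹ * (Matrix.of X)ᵀ

lemma gram_apply (X : Fin n → Fin D → ℝ) (a b : Fin D) :
    gram (Matrix.of X) a b = ∑ l, X l a * X l b := by
  simp [gram, Matrix.mul_apply]

lemma isSymm_gram (X : Matrix (Fin n) (Fin D) ℝ) : (gram X).IsSymm := by
  simp [gram, Matrix.IsSymm]

/-- The inverse is the adjugate divided by the determinant; both are continuous in `X`, and scalar
inversion is measurable even at `0`. -/
lemma measurable_gram_inv_apply (a b : Fin D) :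
    Measurable fun X : Fin n → Fin D → ℝ => (gram (Matrix.of X))⁻¹ a b := by
  have hg : Continuous fun X : Fin n → Fin D → ℝ => gram (Matrix.of X) := by
    refine continuous_matrix fun a b => ?_
    simp_rw [gram_apply]
    fun_prop
  have hd : Measurable fun X : Fin n → Fin D → ℝ => (gram (Matrix.of X)).det :=
    hg.matrix_det.measurable
  have ha : Measurable fun X : Fin n → Fin D → ℝ => (gram (Matrix.of X)).adjugate a b :=
    (hg.matrix_adjugate.matrix_elem a b).measurable
  simp only [Matrix.inv_def, Ring.inverse_eq_inv', Matrix.smul_apply, smul_eq_mul]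
  exact hd.inv.mul ha

lemma measurable_pseudoInv_apply (a : Fin D) (l : Fin n) :
    Measurable fun X : Fin n → Fin D → ℝ => pseudoInv X a l := by
  simp only [pseudoInv, Matrix.mul_apply, Matrix.transpose_apply, Matrix.of_apply]
  refine Finset.measurable_sum _ fun b _ => (measurable_gram_inv_apply a b).mul ?_
  fun_prop

/-- With `G = XᵀX` symmetric, `P Pᵀ = G⁻¹ (XᵀX) G⁻¹ = G⁻¹`. This is the covariance of the estimate
for unit noise. -/
lemma sum_pseudoInv_mul_pseudoInv {X : Fin n → Fin D → ℝ} (hX : IsUnit (gram (Matrix.of X)))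
    (a b : Fin D) : ∑ l, pseudoInv X a l * pseudoInv X b l = (gram (Matrix.of X))⁻¹ a b := by
  have hdet := (Matrix.isUnit_iff_isUnit_det _).1 hX
  have : pseudoInv X * (pseudoInv X)ᵀ = (gram (Matrix.of X))⁻¹ := by
    rw [pseudoInv, Matrix.transpose_mul, Matrix.transpose_transpose, Matrix.transpose_nonsing_inv,
      isSymm_gram, Matrix.mul_assoc, ← Matrix.mul_assoc _ _ (gram (Matrix.of X))⁻¹]
    change _ * (gram (Matrix.of X) * _) = _
    rw [Matrix.mul_nonsing_inv _ hdet, Matrix.mul_one]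
  rw [← this, Matrix.mul_apply]
  rfl

lemma ols_eq_pseudoInv_mulVec (z : Fin n → (Fin D → ℝ) × ℝ) :
    ols z = pseudoInv (fun l => (z l).1) *ᵥ fun l => (z l).2 := by
  simp [ols, pseudoInv, Matrix.mulVec_mulVec]

lemma measurable_ols_apply (a : Fin D) :
    Measurable fun z : Fin n → (Fin D → ℝ) × ℝ => ols z a := by
  simp only [ols_eq_pseudoInv_mulVec, Matrix.mulVec, dotProduct]
  refine Finset.measurable_sum _ fun l _ => Measurable.mul ?_ (by fun_prop)
  exact (measurable_pseudoInv_apply a l).comp (by fun_prop)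

/-- `P X = 1`, so least squares recovers `θ` from the noiseless labels `Xθ` and only the noise `Y -
Xθ` is left. -/
lemma ols_sub_eq_noise {z : Fin n → (Fin D → ℝ) × ℝ}
    (hX : IsUnit (gram (Matrix.of fun l => (z l).1))) (θ : Fin D → ℝ) (a : Fin D) :
    ols z a - θ a = ∑ l, pseudoInv (fun l => (z l).1) a l * ((z l).2 - (z l).1 ⬝ᵥ θ) := by
  have hdet := (Matrix.isUnit_iff_isUnit_det _).1 hX
  have h1 : pseudoInv (fun l => (z l).1) *ᵥ (fun l => (z l).1 ⬝ᵥ θ) = θ := by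
    change pseudoInv (fun l => (z l).1) *ᵥ (Matrix.of (fun l => (z l).1) *ᵥ θ) = θ
    rw [Matrix.mulVec_mulVec, pseudoInv, Matrix.mul_assoc]
    change (_ * gram _) *ᵥ θ = θ
    rw [Matrix.nonsing_inv_mul _ hdet, Matrix.one_mulVec]
  conv_lhs => rw [← h1]
  rw [ols_eq_pseudoInv_mulVec]
  simp only [Matrix.mulVec, dotProduct, ← Finset.sum_sub_distrib, mul_sub]

variable (R : RegressionModel M D)

instance (i : Fin M) : IsProbabilityMeasure (R.designLaw i) := by
  unfold designLaw; infer_instance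

/-- The law of a label given the parameters of player `i` and its inputs. -/
noncomputable def labelKernel (i : Fin M) (l : Fin (R.n i)) :
    Kernel (((Fin D → ℝ) × ℝ) × (Fin (R.n i) → Fin D → ℝ)) ℝ :=
  (R.labelDist i).comap (fun b => (b.2 l ⬝ᵥ b.1.1, b.1.2)) (by unfold dotProduct; fun_prop)

instance (i : Fin M) (l : Fin (R.n i)) : IsMarkovKernel (R.labelKernel i l) := by
  unfold labelKernel; infer_instance

/-- Rearranges parameters, inputs and labels as labelled samples. -/
def zipData (i : Fin M) (q : (((Fin D → ℝ) × ℝ) × (Fin (R.n i) → Fin D → ℝ)) × (Fin (R.n i) → ℝ)) :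
    R.PlayerData i :=
  (q.1.1, fun l => (q.1.2 l, q.2 l))

lemma measurable_zipData (i : Fin M) : Measurable (R.zipData i) := by
  unfold zipData; fun_prop

/-- The data of a player are obtained by drawing parameters and inputs independently, and then
the labels. -/
lemma map_zipData (i : Fin M) :
    (((R.paramDist.prod (R.designLaw i)) ⊗ₘ piKernel (R.labelKernel i)).map (R.zipData i))
      = R.playerLaw i := by
  ext s hs
  rw [Measure.map_apply (R.measurable_zipData i) hs,
    Measure.compProd_apply (R.measurable_zipData i hs),
    lintegral_prod _ (Kernel.measurable_kernel_prodMk_left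
      (R.measurable_zipData i hs)).aemeasurable, playerLaw]
  -- `iidKernel` is definitionally the constant case of `piKernel`.
  change _ = (R.paramDist ⊗ₘ piKernel fun _ : Fin (R.n i) => R.sampleKernel i) s
  rw [Measure.compProd_apply hs]
  refine lintegral_congr fun p => ?_
  have hk : R.sampleKernel i p = R.inputDist i ⊗ₘ (R.labelDist i).comap
      (fun x : Fin D → ℝ => (x ⬝ᵥ p.1, p.2)) (by unfold dotProduct; fun_prop) := by
    ext t ht
    rw [sampleKernel, Kernel.compProd_apply ht, Measure.compProd_apply ht]
    rfl
  have hz : Measurable fun (q : (Fin (R.n i) → Fin D → ℝ) × (Fin (R.n i) → ℝ))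
      (l : Fin (R.n i)) => (q.1 l, q.2 l) := by fun_prop
  have hst : MeasurableSet (Prod.mk p ⁻¹' s) := measurable_prodMk_left hs
  rw [piKernel_apply, hk, ← map_compProd_piKernel_eq_pi, Measure.map_apply hz hst,
    Measure.compProd_apply (hz hst)]
  rfl

variable {R}

/-- The label assumption concerns one input. It pulls back along the measure-preserving projection
to each row, and there are finitely many rows. -/
lemma Standing.hasMeanVar (hR : R.Standing) (i : Fin M) :
    ∀ᵐ b ∂(R.paramDist.prod (R.designLaw i)), HasMeanVar (R.labelKernel i)
      (fun l b => b.2 l ⬝ᵥ b.1.1) (fun b => b.1.2) b := by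
  refine ae_all_iff.2 fun l => ?_
  have hmp : MeasurePreserving
      (fun b : ((Fin D → ℝ) × ℝ) × (Fin (R.n i) → Fin D → ℝ) => (b.1, b.2 l))
      (R.paramDist.prod (R.designLaw i)) (R.paramDist.prod (R.inputDist i)) :=
    (MeasurePreserving.id _).prod (measurePreserving_eval (fun _ => R.inputDist i) l)
  exact hmp.quasiMeasurePreserving.ae (hR.label i)

lemma Standing.ae_gram (hR : R.Standing) (i : Fin M) :
    ∀ᵐ b ∂(R.paramDist.prod (R.designLaw i)), IsUnit (gram (Matrix.of b.2)) :=
  Measure.quasiMeasurePreserving_snd.ae (hR.gram_isUnit i)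

end RegressionModel

/-! ### Expected error of federated regression -/

namespace RegressionModel

variable {M D : ℕ} {R : RegressionModel M D}

/-- The contribution of player `i` to the error, with weights `α` of the estimation error and `β`
of the deviation of its coefficients from their mean. -/
noncomputable def playerError (R : RegressionModel M D) (i : Fin M) (α β : ℝ) (a : Fin D)
    (ω : R.PlayerData i) : ℝ :=
  α * (ols ω.2 a - ω.1.1 a) + β * (ω.1.1 a - ∫ p, p.1 a ∂(R.paramDist))

lemma measurable_playerError (i : Fin M) (α β : ℝ) (a : Fin D) :
    Measurable (R.playerError i α β a) := by
  unfold playerError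
  have : Measurable fun ω : R.PlayerData i => ols ω.2 a :=
    (measurable_ols_apply a).comp measurable_snd
  fun_prop

/-- The identity needs an invertible Gram matrix, hence holds only almost everywhere; it transfers
the moment formulas for `noiseAdd` to the regression error. -/
lemma Standing.playerError_zipData_ae_eq (hR : R.Standing) (i : Fin M) (α β : ℝ) (a : Fin D) :
    (R.playerError i α β a) ∘ (R.zipData i)
      =ᵐ[(R.paramDist.prod (R.designLaw i)) ⊗ₘ piKernel (R.labelKernel i)]
    noiseAdd α β (fun l b => b.2 l ⬝ᵥ b.1.1) (fun l b => pseudoInv b.2 a l)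
      (fun b => b.1.1 a - ∫ p, p.1 a ∂(R.paramDist)) := by
  have hfst : MeasurePreserving Prod.fst
      ((R.paramDist.prod (R.designLaw i)) ⊗ₘ piKernel (R.labelKernel i))
      (R.paramDist.prod (R.designLaw i)) := ⟨measurable_fst, Measure.fst_compProd _ _⟩
  filter_upwards [hfst.quasiMeasurePreserving.ae (hR.ae_gram i)] with q hq
  have := ols_sub_eq_noise (z := fun l => (q.1.2 l, q.2 l)) hq q.1.1.1 a
  simp only [Function.comp_apply, playerError, zipData, this, noiseAdd, noise]

lemma memLp_coeff_sub (hR : R.Standing) (i : Fin M) (a : Fin D) :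
    MemLp (fun b : ((Fin D → ℝ) × ℝ) × (Fin (R.n i) → Fin D → ℝ) =>
      b.1.1 a - ∫ p, p.1 a ∂(R.paramDist)) 2 (R.paramDist.prod (R.designLaw i)) :=
  (memLp_sub_integral (hR.coeff_memLp a)).comp_fst _

lemma Standing.noise_mul_sum_ae_eq (hR : R.Standing) (i : Fin M) (a b : Fin D) :
    (fun p : ((Fin D → ℝ) × ℝ) × (Fin (R.n i) → Fin D → ℝ) =>
        p.1.2 * (gram (Matrix.of p.2))⁻¹ a b) =ᵐ[R.paramDist.prod (R.designLaw i)]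
      fun p => p.1.2 * ∑ l, pseudoInv p.2 a l * pseudoInv p.2 b l := by
  filter_upwards [hR.ae_gram i] with p hp
  rw [sum_pseudoInv_mul_pseudoInv hp]

lemma Standing.integrable_noise_mul (hR : R.Standing) {i : Fin M} (hi : R.InvGramIntegrable i)
    (a : Fin D) :
    Integrable (fun p : ((Fin D → ℝ) × ℝ) × (Fin (R.n i) → Fin D → ℝ) =>
      p.1.2 * ∑ l, pseudoInv p.2 a l * pseudoInv p.2 a l) (R.paramDist.prod (R.designLaw i)) :=
  (hR.noise_integrable.mul_prod (hi a a)).congr (hR.noise_mul_sum_ae_eq i a a)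

lemma measurable_dotProduct_coeff (i : Fin M) (l : Fin (R.n i)) :
    Measurable fun b : ((Fin D → ℝ) × ℝ) × (Fin (R.n i) → Fin D → ℝ) => b.2 l ⬝ᵥ b.1.1 := by
  unfold dotProduct; fun_prop

lemma measurable_pseudoInv_snd (i : Fin M) (a : Fin D) (l : Fin (R.n i)) :
    Measurable fun b : ((Fin D → ℝ) × ℝ) × (Fin (R.n i) → Fin D → ℝ) => pseudoInv b.2 a l :=
  (measurable_pseudoInv_apply a l).comp measurable_snd

lemma Standing.memLp_playerError (hR : R.Standing) {i : Fin M} (hi : R.InvGramIntegrable i)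
    (α β : ℝ) (a : Fin D) : MemLp (R.playerError i α β a) 2 (R.playerLaw i) := by
  rw [← map_zipData, memLp_map_measure_iff (measurable_playerError i α β a).aestronglyMeasurable
    (R.measurable_zipData i).aemeasurable, memLp_congr_ae (hR.playerError_zipData_ae_eq i α β a)]
  exact memLp_noiseAdd (hR.hasMeanVar i) (measurable_dotProduct_coeff i)
    (measurable_pseudoInv_snd i a) (hR.integrable_noise_mul hi a) (memLp_coeff_sub hR i a) α β

lemma Standing.integral_playerError (hR : R.Standing) {i : Fin M} (hi : R.InvGramIntegrable i)
    (α β : ℝ) (a : Fin D) : ∫ ω, R.playerError i α β a ω ∂(R.playerLaw i) = 0 := by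
  rw [← map_zipData, integral_map (R.measurable_zipData i).aemeasurable
    (measurable_playerError i α β a).aestronglyMeasurable]
  refine (integral_congr_ae (hR.playerError_zipData_ae_eq i α β a)).trans ?_
  refine integral_noiseAdd (hR.hasMeanVar i) (measurable_dotProduct_coeff i)
    (measurable_pseudoInv_snd i a) (hR.integrable_noise_mul hi a) (memLp_coeff_sub hR i a) ?_ α β
  rw [integral_fun_fst (fun p : (Fin D → ℝ) × ℝ => p.1 a - ∫ p, p.1 a ∂(R.paramDist)),
    integral_sub_integral (hR.coeff_memLp a), smul_zero]

/-- Independence of the coordinates of `θ` enters here: it leaves only the diagonal second moments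
of the test point in the bias term. -/
lemma Standing.integral_coeff_sub_mul (hR : R.Standing) (a b : Fin D) :
    ∫ p, (p.1 a - ∫ q, q.1 a ∂(R.paramDist)) * (p.1 b - ∫ q, q.1 b ∂(R.paramDist)) ∂(R.paramDist)
      = if a = b then R.coeffVar a else 0 := by
  split_ifs with h
  · subst h
    rw [coeffVar, variance_eq_integral (hR.coeff_memLp a).1.aemeasurable]
    simp_rw [sq]
  · exact (hR.coeff_indep.indepFun h).covariance_eq_zero (hR.coeff_memLp a) (hR.coeff_memLp b)

lemma Standing.integral_playerError_mul (hR : R.Standing) {i : Fin M}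
    (hi : R.InvGramIntegrable i) (α β : ℝ) (a b : Fin D) :
    ∫ ω, R.playerError i α β a ω * R.playerError i α β b ω ∂(R.playerLaw i)
      = α ^ 2 * (R.meanNoise * R.expInvGram i a b)
        + β ^ 2 * if a = b then R.coeffVar a else 0 := by
  rw [← map_zipData]
  refine (integral_map (R.measurable_zipData i).aemeasurable ((measurable_playerError i α β a).mul
    (measurable_playerError i α β b)).aestronglyMeasurable).trans ?_
  refine (integral_congr_ae ((hR.playerError_zipData_ae_eq i α β a).mul
    (hR.playerError_zipData_ae_eq i α β b))).trans ?_
  refine (integral_noiseAdd_mul_noiseAdd (hR.hasMeanVar i) (measurable_dotProduct_coeff i)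
    (measurable_pseudoInv_snd i a) (measurable_pseudoInv_snd i b) (hR.integrable_noise_mul hi a)
    (hR.integrable_noise_mul hi b) (memLp_coeff_sub hR i a) (memLp_coeff_sub hR i b) α β).trans ?_
  congr 2
  · rw [← integral_congr_ae (hR.noise_mul_sum_ae_eq i a b)]
    exact integral_prod_mul (fun p : (Fin D → ℝ) × ℝ => p.2)
      fun X : Fin (R.n i) → Fin D → ℝ => (gram (Matrix.of X))⁻¹ a b
  · rw [← hR.integral_coeff_sub_mul a b, integral_fun_fst (fun p : (Fin D → ℝ) × ℝ =>
      (p.1 a - ∫ q, q.1 a ∂(R.paramDist)) * (p.1 b - ∫ q, q.1 b ∂(R.paramDist)))]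
    simp

/-- Expanding the square separates the players' data from the test point in each term, so that the
integral over the product measure factors. -/
lemma sqError_eq {v : Fin M → ℝ} (hv : ∑ i, v i = 1) (j : Fin M)
    (ω : (∀ i, R.PlayerData i) × (Fin D → ℝ)) :
    R.sqError v j ω = ∑ a, ∑ b,
      ((∑ i, R.playerError i (v i) (v i - if i = j then 1 else 0) a (ω.1 i)) *
        ∑ i, R.playerError i (v i) (v i - if i = j then 1 else 0) b (ω.1 i)) *
      (ω.2 a * ω.2 b) := by
  have h : ∀ a, ∑ i, R.playerError i (v i) (v i - if i = j then 1 else 0) a (ω.1 i)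
      = R.fineGrained v ω.1 a - (ω.1 j).1.1 a := by
    intro a
    have hi : ∀ i, R.playerError i (v i) (v i - if i = j then 1 else 0) a (ω.1 i)
        = v i * ols (ω.1 i).2 a - (v i * ∫ p, p.1 a ∂(R.paramDist)
          + ((ω.1 i).1.1 a - ∫ p, p.1 a ∂(R.paramDist)) * if i = j then 1 else 0) := by
      intro i
      unfold playerError
      ring
    simp_rw [hi, Finset.sum_sub_distrib, Finset.sum_add_distrib, ← Finset.sum_mul, hv]
    simp [fineGrained]
  simp_rw [h]
  rw [sqError, ← dotProduct_sub, sq, dotProduct, Finset.sum_mul_sum]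
  refine Finset.sum_congr rfl fun a _ => Finset.sum_congr rfl fun b _ => ?_
  simp only [Pi.sub_apply]
  ring

theorem Standing.integrable_sqError_and_expectedMSE_eq (hR : R.Standing)
    (hi : ∀ i, R.InvGramIntegrable i) (j : Fin M) {v : Fin M → ℝ} (hv : ∑ i, v i = 1) :
    Integrable (R.sqError v j) (R.jointLaw j) ∧
      R.expectedMSE v j = R.varianceTerm v j +
        biasWeight v j * ∑ d, (∫ x, x d ^ 2 ∂(R.inputDist j)) * R.coeffVar d := by
  set W : ∀ i, Fin D → R.PlayerData i → ℝ :=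
    fun i => R.playerError i (v i) (v i - if i = j then 1 else 0)
  have hsq : R.sqError v j = fun ω => ∑ a, ∑ b,
      ((∑ i, W i a (ω.1 i)) * ∑ i, W i b (ω.1 i)) * (ω.2 a * ω.2 b) := funext (sqError_eq hv j)
  have hS : ∀ a, MemLp (fun ω : ∀ i, R.PlayerData i => ∑ i, W i a (ω i)) 2
      (Measure.pi R.playerLaw) :=
    fun a => memLp_two_sum_pi fun i => hR.memLp_playerError (hi i) _ _ a
  have hint : ∀ a b, Integrable (fun ω : (∀ i, R.PlayerData i) × (Fin D → ℝ) =>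
      ((∑ i, W i a (ω.1 i)) * ∑ i, W i b (ω.1 i)) * (ω.2 a * ω.2 b)) (R.jointLaw j) :=
    fun a b => Integrable.mul_prod
      (f := fun ω : ∀ i, R.PlayerData i => (∑ i, W i a (ω i)) * ∑ i, W i b (ω i))
      (g := fun x : Fin D → ℝ => x a * x b) ((hS a).integrable_mul (hS b))
      ((hR.input_memLp j a).integrable_mul (hR.input_memLp j b))
  -- The index order `secondMoment j b a`, `expInvGram i a b` is the one in which the double sum is
  -- a trace.
  have hval : ∀ a b, ∫ ω : (∀ i, R.PlayerData i) × (Fin D → ℝ),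
      ((∑ i, W i a (ω.1 i)) * ∑ i, W i b (ω.1 i)) * (ω.2 a * ω.2 b) ∂(R.jointLaw j)
      = (∑ i, v i ^ 2 * (R.meanNoise * (R.secondMoment j b a * R.expInvGram i a b)))
        + if a = b then biasWeight v j * ((∫ x, x a ^ 2 ∂(R.inputDist j)) * R.coeffVar a)
          else 0 := by
    intro a b
    refine (integral_prod_mul
      (fun ω : ∀ i, R.PlayerData i => (∑ i, W i a (ω i)) * ∑ i, W i b (ω i))
      (fun x : Fin D → ℝ => x a * x b)).trans ?_
    rw [integral_sum_mul_sum_pi (fun i => hR.memLp_playerError (hi i) _ _ a)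
      (fun i => hR.memLp_playerError (hi i) _ _ b) fun i => hR.integral_playerError (hi i) _ _ a]
    simp_rw [hR.integral_playerError_mul (hi _)]
    rw [Finset.sum_add_distrib, ← Finset.sum_mul, sum_sq_sub_indicator_eq_biasWeight hv, add_mul,
      Finset.sum_mul]
    congr 1
    · refine Finset.sum_congr rfl fun i _ => ?_
      have : R.secondMoment j b a = ∫ x, x a * x b ∂(R.inputDist j) := by
        simp [secondMoment, mul_comm]
      rw [this]
      ring
    · split_ifs with h
      · subst h
        simp_rw [← sq]
        ring
      · simp
  constructor
  · rw [hsq]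
    exact integrable_finsetSum _ fun a _ => integrable_finsetSum _ fun b _ => hint a b
  · rw [expectedMSE, hsq, integral_finsetSum _ fun a _ => integrable_finsetSum _ fun b _ => hint a b]
    simp_rw [integral_finsetSum _ fun b _ => hint _ b, hval, Finset.sum_add_distrib]
    congr 1
    · rw [varianceTerm, Finset.mul_sum]
      simp_rw [Matrix.trace, Matrix.diag_apply, Matrix.mul_apply, Finset.mul_sum]
      refine Finset.sum_comm.trans ((Finset.sum_congr rfl fun b _ => Finset.sum_comm).trans
        (Finset.sum_comm.trans ?_))
      exact Finset.sum_congr rfl fun i _ => Finset.sum_congr rfl fun b _ =>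
        Finset.sum_congr rfl fun a _ => by ring
    · simp [Finset.mul_sum]

end RegressionModel

/-! ### The mean of an inverse chi-square variable -/

section InverseChiSquare

/-- Completing the exponents gives a Gaussian integral with parameter `t + 1/2`. The product over
`m` independent coordinates is the Laplace transform of `χ²_m`. -/
lemma lintegral_exp_neg_mul_sq_gaussianReal {t : ℝ} (ht : 0 ≤ t) :
    ∫⁻ x, ENNReal.ofReal (Real.exp (-t * x ^ 2)) ∂(gaussianReal 0 1)
      = ENNReal.ofReal ((1 + 2 * t) ^ (-(1 / 2) : ℝ)) := by
  have hint : Integrable (fun x : ℝ => Real.exp (-t * x ^ 2)) (gaussianReal 0 1) := by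
    refine Integrable.of_bound (C := 1) (by fun_prop) (Filter.Eventually.of_forall fun x => ?_)
    rw [Real.norm_of_nonneg (Real.exp_pos _).le, Real.exp_le_one_iff]
    nlinarith [mul_nonneg ht (sq_nonneg x)]
  rw [← ofReal_integral_eq_lintegral_ofReal hint
    (Filter.Eventually.of_forall fun x => (Real.exp_pos _).le),
    integral_gaussianReal_eq_integral_smul one_ne_zero]
  congr 1
  have h : ∀ x : ℝ, gaussianPDFReal 0 1 x • Real.exp (-t * x ^ 2)
      = (√(2 * Real.pi))⁻¹ * Real.exp (-(t + 1 / 2) * x ^ 2) := by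
    intro x
    simp only [gaussianPDFReal, smul_eq_mul, NNReal.coe_one, mul_one, sub_zero]
    rw [mul_assoc, ← Real.exp_add]
    congr 2
    ring
  have hpos : 0 < 1 + 2 * t := by linarith
  simp_rw [h]
  rw [integral_const_mul, integral_gaussian, ← Real.sqrt_inv, ← Real.sqrt_mul (by positivity),
    Real.rpow_neg hpos.le, ← Real.sqrt_eq_rpow, ← Real.sqrt_inv]
  congr 1
  field_simp
  ring

lemma lintegral_Ioi_exp_neg_mul {s : ℝ} (hs : 0 < s) :
    ∫⁻ t in Set.Ioi (0 : ℝ), ENNReal.ofReal (Real.exp (-t * s)) = ENNReal.ofReal s⁻¹ := by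
  have hs' : -s < 0 := by linarith
  have h := integral_exp_mul_Ioi hs' 0
  have hi := integrableOn_exp_mul_Ioi hs' 0
  have he : ∀ t : ℝ, -t * s = -s * t := fun t => by ring
  simp_rw [he]
  rw [← ofReal_integral_eq_lintegral_ofReal hi
    (Filter.Eventually.of_forall fun x => (Real.exp_pos _).le), h]
  congr 1
  simp

lemma lintegral_Ioi_one_add_two_mul_rpow {a : ℝ} (ha : 1 < a) :
    ∫⁻ t in Set.Ioi (0 : ℝ), ENNReal.ofReal ((1 + 2 * t) ^ (-a))
      = ENNReal.ofReal (1 / (2 * a - 2)) := by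
  -- This antiderivative tends to `0` at infinity because `1 < a`. Below, `a = m / 2`, hence the
  -- requirement `3 ≤ m`.
  have hd : ∀ x ∈ Set.Ici (0 : ℝ), HasDerivAt
      (fun t : ℝ => -((1 + 2 * t) ^ (1 - a)) / (2 * a - 2)) ((1 + 2 * x) ^ (-a)) x := by
    intro x hx
    have hx' : 0 < 1 + 2 * x := by have : (0 : ℝ) ≤ x := hx; linarith
    have h1 : HasDerivAt (fun t : ℝ => 1 + 2 * t) 2 x := by
      simpa using ((hasDerivAt_id x).const_mul 2).const_add 1
    have h2 := ((h1.rpow_const (p := 1 - a) (Or.inl hx'.ne')).neg).div_const (2 * a - 2)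
    have hne : 2 * a - 2 ≠ 0 := by linarith
    have hval : -(2 * (1 - a) * (1 + 2 * x) ^ (1 - a - 1)) / (2 * a - 2) = (1 + 2 * x) ^ (-a) := by
      rw [show 1 - a - 1 = -a by ring, div_eq_iff hne]
      ring
    exact hval ▸ h2
  have hnn : ∀ x ∈ Set.Ioi (0 : ℝ), 0 ≤ (1 + 2 * x) ^ (-a) := by
    intro x hx
    have : (0 : ℝ) < x := hx
    positivity
  have hl : Filter.Tendsto (fun t : ℝ => -((1 + 2 * t) ^ (1 - a)) / (2 * a - 2)) Filter.atTop
      (nhds 0) := by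
    have h1 : Filter.Tendsto (fun t : ℝ => 1 + 2 * t) Filter.atTop Filter.atTop :=
      Filter.tendsto_atTop_add_const_left _ _ (Filter.tendsto_id.const_mul_atTop two_pos)
    have h2 := (tendsto_rpow_neg_atTop (y := a - 1) (by linarith)).comp h1
    have h3 := (h2.neg).div_const (2 * a - 2)
    simpa [Function.comp_def] using h3
  have hi := integrableOn_Ioi_deriv_of_nonneg' hd hnn hl
  rw [← ofReal_integral_eq_lintegral_ofReal hi
    ((ae_restrict_iff' measurableSet_Ioi).2 (Filter.Eventually.of_forall hnn)),
    integral_Ioi_of_hasDerivAt_of_nonneg' hd hnn hl]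
  congr 1
  simp [neg_div]

/-- The expectation of the inverse of a `χ²` variable with `m` degrees of freedom. -/
lemma lintegral_inv_sum_sq_pi_gaussianReal {m : ℕ} (hm : 3 ≤ m) :
    ∫⁻ x, ENNReal.ofReal (∑ i, x i ^ 2)⁻¹ ∂(Measure.pi fun _ : Fin m => gaussianReal 0 1)
      = ENNReal.ofReal (1 / ((m : ℝ) - 2)) := by
  set γ := Measure.pi fun _ : Fin m => gaussianReal 0 1
  -- At a zero sum the convention `0⁻¹ = 0` would contradict the divergent integral of `exp 0`;
  -- already the first coordinate is almost surely nonzero.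
  have hpos : ∀ᵐ x ∂γ, 0 < ∑ i, x i ^ 2 := by
    have i0 : Fin m := ⟨0, by omega⟩
    have : NullSingletonClass (gaussianReal 0 1) := nullSingletonClass_gaussianReal one_ne_zero
    have h0 : ∀ᵐ y ∂(gaussianReal 0 1), y ≠ 0 := by
      simp only [ae_iff, not_not, Set.ofPred_eq_eq_singleton]
      exact measure_singleton 0
    have := (measurePreserving_eval (fun _ : Fin m => gaussianReal 0 1)
      i0).quasiMeasurePreserving.ae h0
    filter_upwards [this] with x hx
    exact Finset.sum_pos' (fun i _ => sq_nonneg _) ⟨i0, Finset.mem_univ _, by positivity⟩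
  -- Writing `1/s = ∫ exp (-t s) dt` over `t > 0` and exchanging the integrals reduces the claim to
  -- the Laplace transform.
  have hstep : ∫⁻ x, ENNReal.ofReal (∑ i, x i ^ 2)⁻¹ ∂γ
      = ∫⁻ x, (∫⁻ t in Set.Ioi (0 : ℝ), ENNReal.ofReal (Real.exp (-t * ∑ i, x i ^ 2))) ∂γ := by
    refine lintegral_congr_ae ?_
    filter_upwards [hpos] with x hx
    rw [lintegral_Ioi_exp_neg_mul hx]
  rw [hstep, lintegral_lintegral_swap (by fun_prop)]
  have hin : ∀ t ∈ Set.Ioi (0 : ℝ), ∫⁻ x, ENNReal.ofReal (Real.exp (-t * ∑ i, x i ^ 2)) ∂γ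
      = ENNReal.ofReal ((1 + 2 * t) ^ (-((m : ℝ) / 2))) := by
    intro t ht
    have ht0 : (0 : ℝ) < t := ht
    have h1 : ∀ x : Fin m → ℝ, ENNReal.ofReal (Real.exp (-t * ∑ i, x i ^ 2))
        = ∏ i, ENNReal.ofReal (Real.exp (-t * x i ^ 2)) := by
      intro x
      rw [Finset.mul_sum, Real.exp_sum, ENNReal.ofReal_prod_of_nonneg]
      exact fun i _ => (Real.exp_pos _).le
    simp_rw [h1]
    rw [lintegral_prod_eq_prod_lintegral_of_indepFun Finset.univ
      (fun i (x : Fin m → ℝ) => ENNReal.ofReal (Real.exp (-t * x i ^ 2)))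
      (iIndepFun_pi (X := fun _ (y : ℝ) => ENNReal.ofReal (Real.exp (-t * y ^ 2)))
        fun i => by fun_prop) (fun i => by fun_prop)]
    have h2 : ∀ i : Fin m, ∫⁻ x, ENNReal.ofReal (Real.exp (-t * x i ^ 2)) ∂γ
        = ENNReal.ofReal ((1 + 2 * t) ^ (-(1 / 2) : ℝ)) := by
      intro i
      rw [← lintegral_exp_neg_mul_sq_gaussianReal ht0.le]
      exact (measurePreserving_eval (fun _ : Fin m => gaussianReal 0 1) i).lintegral_comp
        (f := fun y : ℝ => ENNReal.ofReal (Real.exp (-t * y ^ 2))) (by fun_prop)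
    rw [Finset.prod_congr rfl fun i _ => h2 i, Finset.prod_const, Finset.card_univ, Fintype.card_fin,
      ← ENNReal.ofReal_pow (by positivity), ← Real.rpow_natCast, ← Real.rpow_mul (by positivity)]
    congr 2
    ring
  have hm' : (3 : ℝ) ≤ m := by exact_mod_cast hm
  rw [setLIntegral_congr_fun measurableSet_Ioi hin,
    lintegral_Ioi_one_add_two_mul_rpow (by linarith)]
  congr 2
  ring

end InverseChiSquare

/-! ### Orthogonal projections of standard Gaussian vectors -/

section Projection

variable {E : Type*} [NormedAddCommGroup E] [InnerProductSpace ℝ E] [FiniteDimensional ℝ E]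
  [MeasurableSpace E] [BorelSpace E]

lemma lintegral_inv_norm_sq_stdGaussian (hE : 3 ≤ Module.finrank ℝ E) :
    ∫⁻ x, ENNReal.ofReal (‖x‖ ^ 2)⁻¹ ∂(stdGaussian E)
      = ENNReal.ofReal (1 / ((Module.finrank ℝ E : ℝ) - 2)) := by
  rw [stdGaussian, lintegral_map (by fun_prop) (by fun_prop),
    ← lintegral_inv_sum_sq_pi_gaussianReal hE]
  refine lintegral_congr fun x => ?_
  congr 2
  rw [← (stdOrthonormalBasis ℝ E).sum_sq_norm_inner_right]
  refine Finset.sum_congr rfl fun i _ => ?_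
  rw [Real.norm_eq_abs, sq_abs, (stdOrthonormalBasis ℝ E).orthonormal.inner_right_fintype]

/-- A Gaussian measure is determined by mean and covariance. The adjoint of the projection is the
isometric inclusion of `K`, so the covariance is the inner product of `K`. -/
lemma map_orthogonalProjectionOnto_stdGaussian (K : Submodule ℝ E) :
    (stdGaussian E).map K.orthogonalProjectionOnto = stdGaussian K := by
  have hid : MemLp id 2 (stdGaussian E) := IsGaussian.memLp_two_id
  refine IsGaussian.ext ?_ ?_
  · simp only [id_eq]
    rw [ContinuousLinearMap.integral_id_map IsGaussian.integrable_id]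
    simp
  · ext x y
    rw [covarianceBilin_map hid, covarianceBilin_stdGaussian, covarianceBilin_stdGaussian,
      Submodule.adjoint_orthogonalProjectionOnto]
    rfl

lemma lintegral_inv_norm_sq_orthogonalProjectionOnto (K : Submodule ℝ E)
    (hK : 3 ≤ Module.finrank ℝ K) :
    ∫⁻ x, ENNReal.ofReal (‖K.orthogonalProjectionOnto x‖ ^ 2)⁻¹ ∂(stdGaussian E)
      = ENNReal.ofReal (1 / ((Module.finrank ℝ K : ℝ) - 2)) := by
  rw [← lintegral_inv_norm_sq_stdGaussian hK, ← map_orthogonalProjectionOnto_stdGaussian K,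
    lintegral_map (by fun_prop) (by fun_prop)]

end Projection

/-! ### Inverse Gram matrix of a standard normal design -/

namespace RegressionModel

variable {n D : ℕ}

/-- The `a`-th column of the matrix with rows `X l`, as a vector of Euclidean space. -/
noncomputable def column (X : Fin n → Fin D → ℝ) (a : Fin D) : EuclideanSpace ℝ (Fin n) :=
  WithLp.toLp 2 fun l => X l a

lemma gram_mulVec_apply (X : Fin n → Fin D → ℝ) (c : Fin D → ℝ) (a : Fin D) :
    (gram (Matrix.of X) *ᵥ c) a = inner ℝ (column X a) (∑ b, c b • column X b) := by
  simp only [Matrix.mulVec, dotProduct, gram_apply, inner_sum, inner_smul_right]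
  refine Finset.sum_congr rfl fun b _ => ?_
  simp [column, PiLp.inner_apply, Finset.mul_sum, mul_comm, mul_left_comm]

lemma linearIndependent_column {X : Fin n → Fin D → ℝ} (hX : IsUnit (gram (Matrix.of X))) :
    LinearIndependent ℝ (column X) := by
  rw [Fintype.linearIndependent_iff]
  intro c hc
  have h0 : gram (Matrix.of X) *ᵥ c = 0 := by
    ext a
    rw [gram_mulVec_apply, hc, inner_zero_right]
    rfl
  have := Matrix.mulVec_injective_of_isUnit hX (h0.trans (Matrix.mulVec_zero _).symm)
  exact fun i => congrFun this i

/-- The diagonal entries of the inverse Gram matrix are the inverse squared distances of a column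
from the span of the others. -/
lemma gram_inv_apply_self {k : ℕ} {X : Fin n → Fin (k + 1) → ℝ}
    (hX : IsUnit (gram (Matrix.of X))) (d : Fin (k + 1))
    {K : Submodule ℝ (EuclideanSpace ℝ (Fin n))}
    (hK : Submodule.span ℝ (Set.range fun b => column X (d.succAbove b)) = K) :
    (gram (Matrix.of X))⁻¹ d d = (‖Kᗮ.orthogonalProjectionOnto (column X d)‖ ^ 2)⁻¹ := by
  subst hK
  set K := Submodule.span ℝ (Set.range fun b => column X (d.succAbove b))
  set r : EuclideanSpace ℝ (Fin n) 
    := ((Kᗮ.orthogonalProjectionOnto (column X d) : Kᗮ) : EuclideanSpace ℝ (Fin n)) with hr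
  have hrK : r ∈ Kᗮ := Submodule.coe_mem _
  have hdK : column X d - r ∈ K := by
    have h : column X d - r ∈ Kᗮᗮ :=
      Submodule.sub_starProjection_mem_orthogonal (K := Kᗮ) (column X d)
    rwa [Submodule.orthogonal_orthogonal] at h
  obtain ⟨c', hc'⟩ := (Submodule.mem_span_range_iff_exists_fun ℝ).1 hdK
  -- These are the coordinates of the residual `r` in the columns, with coefficient `1` at `d`.
  -- Since `r` is orthogonal to the other columns and `⟪column X d, r⟫ = ‖r‖²`, the Gram matrix
  -- sends `c` to `‖r‖²` times the `d`-th unit vector.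
  set c : Fin (k + 1) → ℝ := d.insertNth 1 fun b => -c' b with hc
  have hsum : ∑ b, c b • column X b = r := by
    rw [Fin.sum_univ_succAbove _ d]
    simp only [hc, Fin.insertNth_apply_same, Fin.insertNth_apply_succAbove, one_smul, neg_smul,
      Finset.sum_neg_distrib, hc']
    abel
  have hgram : gram (Matrix.of X) *ᵥ c = Pi.single d (‖r‖ ^ 2) := by
    ext a
    rw [gram_mulVec_apply, hsum]
    rcases Fin.eq_self_or_eq_succAbove d a with rfl | ⟨b, rfl⟩
    · rw [Pi.single_eq_same, ← real_inner_self_eq_norm_sq]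
      have : inner ℝ (column X a - r) r = 0 := hrK _ hdK
      rw [inner_sub_left] at this
      linarith
    · rw [Pi.single_eq_of_ne (Fin.succAbove_ne d b)]
      exact hrK _ (Submodule.subset_span ⟨b, rfl⟩)
  -- This is entry `d` of `c = G⁻¹ (G c)`.
  have hcd : 1 = (gram (Matrix.of X))⁻¹ d d * ‖r‖ ^ 2 := by
    have h1 := congrArg (fun w => ((gram (Matrix.of X))⁻¹ *ᵥ w) d) hgram
    simp only [Matrix.mulVec_mulVec,
      Matrix.nonsing_inv_mul _ ((Matrix.isUnit_iff_isUnit_det _).1 hX), Matrix.one_mulVec,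
      Matrix.mulVec_single] at h1
    simpa [hc, mul_comm] using h1
  exact eq_inv_of_mul_eq_one_left hcd.symm

/-- The entries are inner products of rows of `P`, so `2|xy| ≤ x² + y²` applies. Integrability of
all entries thus follows from that of the diagonal. -/
lemma abs_gram_inv_apply_le {X : Fin n → Fin D → ℝ} (hX : IsUnit (gram (Matrix.of X)))
    (a b : Fin D) :
    |(gram (Matrix.of X))⁻¹ a b|
      ≤ (gram (Matrix.of X))⁻¹ a a + (gram (Matrix.of X))⁻¹ b b := by
  simp only [← sum_pseudoInv_mul_pseudoInv hX, ← Finset.sum_add_distrib]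
  refine (Finset.abs_sum_le_sum_abs _ _).trans (Finset.sum_le_sum fun l _ => ?_)
  rw [abs_le]
  constructor <;> nlinarith [sq_nonneg (pseudoInv X a l), sq_nonneg (pseudoInv X b l),
    sq_nonneg (pseudoInv X a l + pseudoInv X b l), sq_nonneg (pseudoInv X a l - pseudoInv X b l)]

/-- The law of an `n × D` matrix with independent standard normal entries. -/
noncomputable def stdDesign (n D : ℕ) : Measure (Fin n → Fin D → ℝ) :=
  Measure.pi fun _ => Measure.pi fun _ => gaussianReal 0 1

instance : IsProbabilityMeasure (stdDesign n D) := by unfold stdDesign; infer_instance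

/-- Splits off the `d`-th column of a matrix. -/
def splitColumn {k : ℕ} (n : ℕ) (d : Fin (k + 1)) :
    (Fin n → Fin (k + 1) → ℝ) ≃ᵐ (Fin n → ℝ) × (Fin n → Fin k → ℝ) :=
  (MeasurableEquiv.piCongrRight fun _ => MeasurableEquiv.piFinSuccAbove (fun _ => ℝ) d).trans
    (MeasurableEquiv.arrowProdEquivProdArrow ℝ (Fin k → ℝ) (Fin n))

lemma splitColumn_symm_apply {k : ℕ} (d : Fin (k + 1)) (u : Fin n → ℝ) (Y : Fin n → Fin k → ℝ) :
    (splitColumn n d).symm (u, Y) = fun l => d.insertNth (u l) (Y l) := rfl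

lemma measurePreserving_splitColumn {k : ℕ} (d : Fin (k + 1)) :
    MeasurePreserving (splitColumn n d) (stdDesign n (k + 1))
      ((Measure.pi fun _ => gaussianReal 0 1).prod (stdDesign n k)) := by
  refine (measurePreserving_arrowProdEquivProdArrow ℝ (Fin k → ℝ) (Fin n)
    (fun _ => gaussianReal 0 1) fun _ => Measure.pi fun _ => gaussianReal 0 1).comp ?_
  exact measurePreserving_pi _ _ fun _ =>
    measurePreserving_piFinSuccAbove (fun _ : Fin (k + 1) => gaussianReal 0 1) d

/-- Conditionally on the other columns the `d`-th column is standard normal, so the entry is an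
inverse `χ²` variable with `n - D + 1` degrees of freedom. Its mean does not depend on the columns
fixed. -/
lemma lintegral_gram_inv_stdDesign (hn : D + 1 < n)
    (hunit : ∀ᵐ Z ∂(stdDesign n D), IsUnit (gram (Matrix.of Z))) (d : Fin D) :
    ∫⁻ Z, ENNReal.ofReal ((gram (Matrix.of Z))⁻¹ d d) ∂(stdDesign n D)
      = ENNReal.ofReal (1 / ((n : ℝ) - D - 1)) := by
  obtain ⟨k, rfl⟩ : ∃ k, D = k + 1 := ⟨D - 1, by have := d.pos; omega⟩
  have hmp := (measurePreserving_splitColumn (n := n) d).symm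
  have hmeas : Measurable fun Z : Fin n → Fin (k + 1) → ℝ =>
      ENNReal.ofReal ((gram (Matrix.of Z))⁻¹ d d) :=
    (measurable_gram_inv_apply d d).ennreal_ofReal
  rw [← hmp.lintegral_comp hmeas]
  refine (lintegral_prod_symm _
    (hmeas.comp (splitColumn n d).symm.measurable).aemeasurable).trans ?_
  have hae : ∀ᵐ q ∂((stdDesign n k).prod (Measure.pi fun _ : Fin n => gaussianReal 0 1)),
      IsUnit (gram (Matrix.of ((splitColumn n d).symm q.swap))) :=
    (hmp.comp Measure.measurePreserving_swap).quasiMeasurePreserving.ae hunit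
  have hconst : ∀ᵐ Y ∂(stdDesign n k), ∫⁻ u, ENNReal.ofReal
      ((gram (Matrix.of ((splitColumn n d).symm (u, Y))))⁻¹ d d)
        ∂(Measure.pi fun _ : Fin n => gaussianReal 0 1)
      = ENNReal.ofReal (1 / ((n : ℝ) - (k + 1 : ℕ) - 1)) := by
    filter_upwards [Measure.ae_ae_of_ae_prod hae] with Y hY
    set K : Submodule ℝ (EuclideanSpace ℝ (Fin n)) :=
      Submodule.span ℝ (Set.range (column Y)) with hK
    have hcol : ∀ u, (fun b => column ((splitColumn n d).symm (u, Y)) (d.succAbove b))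
        = column Y := by
      intro u
      funext b
      simp [column, splitColumn_symm_apply]
    have hcold : ∀ u, column ((splitColumn n d).symm (u, Y)) d = WithLp.toLp 2 u := by
      intro u
      simp [column, splitColumn_symm_apply]
    -- `K` does not involve `u`, so one `u` with invertible Gram matrix shows that the fixed columns
    -- are independent.
    have hrank : Module.finrank ℝ K = k := by
      obtain ⟨u, hu⟩ := hY.exists
      have hli := (linearIndependent_column hu).comp _ (Fin.succAbove_right_injective (p := d))
      change LinearIndependent ℝ
        (fun b => column ((splitColumn n d).symm (u, Y)) (d.succAbove b)) at hli
      rw [hcol u] at hli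
      rw [hK, finrank_span_eq_card hli, Fintype.card_fin]
    have hrank' : Module.finrank ℝ Kᗮ = n - k := by
      have := K.finrank_add_finrank_orthogonal
      rw [finrank_euclideanSpace_fin, hrank] at this
      omega
    calc ∫⁻ u, ENNReal.ofReal ((gram (Matrix.of ((splitColumn n d).symm (u, Y))))⁻¹ d d)
          ∂(Measure.pi fun _ : Fin n => gaussianReal 0 1)
        = ∫⁻ u, ENNReal.ofReal (‖Kᗮ.orthogonalProjectionOnto (WithLp.toLp 2 u)‖ ^ 2)⁻¹
          ∂(Measure.pi fun _ : Fin n => gaussianReal 0 1) := by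
          refine lintegral_congr_ae ?_
          filter_upwards [hY] with u hu
          have h := gram_inv_apply_self hu d (congrArg (fun w => Submodule.span ℝ (Set.range w))
            (hcol u))
          rw [Prod.swap_prod_mk, hcold] at h
          rw [h]
      -- With `D = k + 1`, the hypothesis `D + 1 < n` is exactly the bound `3 ≤ n - k` on the
      -- dimension of `Kᗮ`.
      _ = ENNReal.ofReal (1 / ((Module.finrank ℝ Kᗮ : ℝ) - 2)) := by
          rw [← lintegral_inv_norm_sq_orthogonalProjectionOnto Kᗮ (by omega),
            ← map_pi_eq_stdGaussian, lintegral_map (by fun_prop) (by fun_prop)]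
      _ = ENNReal.ofReal (1 / ((n : ℝ) - (k + 1 : ℕ) - 1)) := by
          rw [hrank', Nat.cast_sub (by omega)]
          congr 2
          push_cast
          ring
  refine (lintegral_congr_ae hconst).trans ?_
  simp

lemma integrable_gram_inv_stdDesign (hn : D + 1 < n)
    (hunit : ∀ᵐ Z ∂(stdDesign n D), IsUnit (gram (Matrix.of Z))) (a b : Fin D) :
    Integrable (fun Z => (gram (Matrix.of Z))⁻¹ a b) (stdDesign n D) := by
  have hdiag : ∀ d : Fin D, Integrable (fun Z => (gram (Matrix.of Z))⁻¹ d d) (stdDesign n D) := by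
    intro d
    refine ⟨(measurable_gram_inv_apply d d).aestronglyMeasurable, ?_⟩
    rw [hasFiniteIntegral_iff_ofReal, lintegral_gram_inv_stdDesign hn hunit]
    · exact ENNReal.ofReal_lt_top
    · filter_upwards [hunit] with Z hZ
      rw [← sum_pseudoInv_mul_pseudoInv hZ]
      exact Finset.sum_nonneg fun l _ => mul_self_nonneg _
  refine ((hdiag a).add (hdiag b)).mono' (measurable_gram_inv_apply a b).aestronglyMeasurable ?_
  filter_upwards [hunit] with Z hZ
  exact abs_gram_inv_apply_le hZ a b

/-- Changes the sign of the `a`-th column. -/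
def flipColumn (a : Fin D) (Z : Fin n → Fin D → ℝ) : Fin n → Fin D → ℝ :=
  fun l c => if c = a then -Z l c else Z l c

lemma measurePreserving_flipColumn (a : Fin D) :
    MeasurePreserving (flipColumn a) (stdDesign n D) (stdDesign n D) := by
  refine measurePreserving_pi (f := fun (_ : Fin n) (z : Fin D → ℝ) c => if c = a then -z c else z c)
    _ _ fun _ => measurePreserving_pi
      (f := fun (c : Fin D) (y : ℝ) => if c = a then -y else y) _ _ fun c => ?_
  by_cases h : c = a
  · simp only [h, if_true]
    exact ⟨measurable_neg, by rw [gaussianReal_map_neg, neg_zero]⟩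
  · simp only [h, if_false]
    exact MeasurePreserving.id _

/-- The flip conjugates the Gram matrix, and so its inverse, by a diagonal sign matrix whose entries
at `a` and `b` have opposite signs. -/
lemma gram_inv_flipColumn {a b : Fin D} (hab : a ≠ b) (Z : Fin n → Fin D → ℝ) :
    (gram (Matrix.of (flipColumn a Z)))⁻¹ a b = -(gram (Matrix.of Z))⁻¹ a b := by
  set s : Fin D → ℝ := fun c => if c = a then -1 else 1 with hs
  have h1 : Matrix.of (flipColumn a Z) = Matrix.of Z * Matrix.diagonal s := by
    ext l c
    simp only [Matrix.mul_diagonal, Matrix.of_apply, flipColumn, hs]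
    split_ifs <;> simp
  have hss : Matrix.diagonal s * Matrix.diagonal s = 1 := by
    rw [Matrix.diagonal_mul_diagonal, ← Matrix.diagonal_one]
    congr 1
    funext c
    simp only [hs]
    split_ifs <;> simp
  have hinv : (Matrix.diagonal s)⁻¹ = Matrix.diagonal s := Matrix.inv_eq_left_inv hss
  have h2 : gram (Matrix.of (flipColumn a Z))
      = Matrix.diagonal s * gram (Matrix.of Z) * Matrix.diagonal s := by
    rw [h1, gram, gram, Matrix.transpose_mul, Matrix.diagonal_transpose]
    simp only [Matrix.mul_assoc]
  rw [h2, Matrix.mul_inv_rev, Matrix.mul_inv_rev, hinv, Matrix.diagonal_mul, Matrix.mul_diagonal]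
  simp [hs, hab.symm]

lemma integral_gram_inv_stdDesign (hn : D + 1 < n)
    (hunit : ∀ᵐ Z ∂(stdDesign n D), IsUnit (gram (Matrix.of Z))) (a b : Fin D) :
    ∫ Z, (gram (Matrix.of Z))⁻¹ a b ∂(stdDesign n D)
      = if a = b then 1 / ((n : ℝ) - D - 1) else 0 := by
  split_ifs with h
  · subst h
    have hn' : (D : ℝ) + 1 < n := by exact_mod_cast hn
    rw [integral_eq_lintegral_of_nonneg_ae, lintegral_gram_inv_stdDesign hn hunit,
      ENNReal.toReal_ofReal]
    · exact one_div_nonneg.2 (by linarith)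
    · filter_upwards [hunit] with Z hZ
      rw [← sum_pseudoInv_mul_pseudoInv hZ]
      exact Finset.sum_nonneg fun l _ => mul_self_nonneg _
    · exact (measurable_gram_inv_apply a a).aestronglyMeasurable
  -- The flip preserves the law and negates the entry, so the integral equals its own negative.
  · have hmp := measurePreserving_flipColumn (n := n) a
    have h1 : ∫ Z, (gram (Matrix.of (flipColumn a Z)))⁻¹ a b ∂(stdDesign n D)
        = ∫ Z, (gram (Matrix.of Z))⁻¹ a b ∂(stdDesign n D) := by
      conv_rhs => rw [← hmp.map_eq]
      rw [integral_map hmp.measurable.aemeasurable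
        (measurable_gram_inv_apply a b).aestronglyMeasurable]
    simp_rw [gram_inv_flipColumn h] at h1
    rw [integral_neg] at h1
    linarith

end RegressionModel

/-! ### Centred Gaussian measures as linear images of the standard one -/

section CenteredGaussian

open scoped MatrixOrder

variable {D : ℕ} {ν : Measure (Fin D → ℝ)} [IsGaussian ν]

lemma memLp_two_eval_of_isGaussian (d : Fin D) : MemLp (fun x : Fin D → ℝ => x d) 2 ν :=
  IsGaussian.memLp_dual ν (ContinuousLinearMap.proj (R := ℝ) (φ := fun _ : Fin D => ℝ) d) 2
    (by simp)

/-- The quadratic form at `c` is the expectation of `(∑ c_a x_a)²`. -/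
lemma posSemidef_integral_mul :
    (Matrix.of fun a b : Fin D => ∫ x, x a * x b ∂ν).PosSemidef := by
  refine Matrix.PosSemidef.of_dotProduct_mulVec_nonneg ?_ fun c => ?_
  · ext a b
    simp [mul_comm]
  · have hint : ∀ a b, Integrable (fun x : Fin D → ℝ => c a * c b * (x a * x b)) ν := fun a b =>
      ((memLp_two_eval_of_isGaussian a).integrable_mul
        (memLp_two_eval_of_isGaussian b)).const_mul _
    have h : star c ⬝ᵥ (Matrix.of fun a b : Fin D => ∫ x, x a * x b ∂ν) *ᵥ c
        = ∫ x, (∑ a, c a * x a) ^ 2 ∂ν := by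
      have hsq : ∀ x : Fin D → ℝ, (∑ a, c a * x a) ^ 2 = ∑ a, ∑ b, c a * c b * (x a * x b) := by
        intro x
        rw [sq, Finset.sum_mul_sum]
        exact Finset.sum_congr rfl fun a _ => Finset.sum_congr rfl fun b _ => by ring
      simp_rw [hsq]
      rw [integral_finsetSum _ fun a _ => integrable_finsetSum _ fun b _ => hint a b]
      simp_rw [integral_finsetSum _ fun b _ => hint _ b, integral_const_mul]
      simp only [dotProduct, Matrix.mulVec, Matrix.of_apply, Finset.mul_sum, star_trivial]
      exact Finset.sum_congr rfl fun a _ => Finset.sum_congr rfl fun b _ => by ring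
    rw [h]
    exact integral_nonneg fun x => sq_nonneg _

/-- A centred Gaussian measure is the image of the standard Gaussian measure under a square root
of its covariance matrix. -/
lemma exists_map_mulVec_eq_of_isGaussian (h0 : ∀ d, ∫ x, x d ∂ν = 0) :
    ∃ S : Matrix (Fin D) (Fin D) ℝ, S * Sᵀ = (Matrix.of fun a b => ∫ x, x a * x b ∂ν) ∧
      (Measure.pi fun _ => gaussianReal 0 1).map (fun x => S *ᵥ x) = ν := by
  set C : Matrix (Fin D) (Fin D) ℝ := Matrix.of fun a b => ∫ x, x a * x b ∂ν with hC
  have hpos : C.PosSemidef := posSemidef_integral_mul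
  set S := CFC.sqrt C with hS
  have hsym : Sᵀ = S := by
    have : IsSelfAdjoint S := (CFC.sqrt_nonneg C).isSelfAdjoint
    simpa [IsSelfAdjoint, Matrix.star_eq_conjTranspose] using this
  refine ⟨S, ?_, ?_⟩
  · rw [hsym]
    exact CFC.sqrt_mul_sqrt_self C hpos.nonneg
  · let L := (EuclideanSpace.equiv (Fin D) ℝ).symm
    have hL : IsGaussian (ν.map L) := by infer_instance
    -- Mean and covariance are compared in Euclidean space, where the covariance form refers to the
    -- inner product. As the means vanish, covariances are second moments.
    have hν : ν.map (WithLp.toLp 2) = multivariateGaussian 0 C := by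
      change ν.map L = _
      refine IsGaussian.ext ?_ ?_
      · simp only [id_eq, integral_id_multivariateGaussian]
        have hid : Integrable (fun x : Fin D → ℝ => x) ν := IsGaussian.integrable_id
        have : ∫ x, x ∂(ν.map L) = L (∫ x, x ∂ν) := by
          rw [integral_map L.continuous.measurable.aemeasurable (by fun_prop)]
          exact L.toContinuousLinearMap.integral_comp_comm hid
        rw [this]
        have hz : ∫ x, x ∂ν = 0 := by
          funext d
          exact ((ContinuousLinearMap.proj (R := ℝ) (φ := fun _ : Fin D => ℝ)
            d).integral_comp_comm hid).symm.trans (h0 d)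
        rw [hz, map_zero]
      · ext x y
        rw [covarianceBilin_multivariateGaussian hpos]
        refine (covarianceBilin_apply_pi (μ := ν) (X := fun i x => x i)
          memLp_two_eval_of_isGaussian x y).trans ?_
        simp only [dotProduct, Matrix.mulVec, Finset.mul_sum]
        refine Finset.sum_congr rfl fun a _ => Finset.sum_congr rfl fun b _ => ?_
        rw [covariance_eq_sub (memLp_two_eval_of_isGaussian a) (memLp_two_eval_of_isGaussian b),
          h0, h0]
        simp [hC]
        ring
    have h2 : (ν.map (WithLp.toLp 2)).map WithLp.ofLp = ν := by
      rw [Measure.map_map (by fun_prop) (by fun_prop)]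
      exact Measure.map_id
    rw [← h2, hν, multivariateGaussian, ← map_pi_eq_stdGaussian,
      Measure.map_map (by fun_prop) (by fun_prop), Measure.map_map (by fun_prop) (by fun_prop)]
    congr 1
    funext x
    simp [hS]

end CenteredGaussian

/-! ### Normal inputs with general covariance -/

namespace RegressionModel

variable {M D : ℕ} {R : RegressionModel M D}

lemma gram_mulVec_rows {n : ℕ} (S : Matrix (Fin D) (Fin D) ℝ) (Z : Fin n → Fin D → ℝ) :
    gram (Matrix.of fun l => S *ᵥ Z l) = S * gram (Matrix.of Z) * Sᵀ := by
  have : (Matrix.of fun l => S *ᵥ Z l) = Matrix.of Z * Sᵀ := by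
    ext l a
    simp [Matrix.mul_apply, Matrix.mulVec, dotProduct, mul_comm]
  rw [this, gram, gram, Matrix.transpose_mul, Matrix.transpose_transpose]
  simp only [Matrix.mul_assoc]

/-- The expectation of the inverse Gram matrix of centred normal inputs. -/
theorem Standing.invGramIntegrable_and_expInvGram_eq (hR : R.Standing) (i : Fin M)
    (hG : IsGaussian (R.inputDist i)) (h0 : ∀ d, ∫ x, x d ∂(R.inputDist i) = 0)
    (hn : D + 1 < R.n i) :
    IsUnit (R.secondMoment i) ∧ R.InvGramIntegrable i ∧
      R.expInvGram i = (1 / ((R.n i : ℝ) - D - 1)) • (R.secondMoment i)⁻¹ := by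
  obtain ⟨S, hS, hmap⟩ := exists_map_mulVec_eq_of_isGaussian h0
  have hmul : Measurable fun x : Fin D → ℝ => S *ᵥ x := by
    refine measurable_pi_iff.2 fun a => ?_
    change Measurable fun x : Fin D → ℝ => ∑ b, S a b * x b
    fun_prop
  have hmp : MeasurePreserving (fun (Z : Fin (R.n i) → Fin D → ℝ) l => S *ᵥ Z l)
      (stdDesign (R.n i) D) (R.designLaw i) :=
    measurePreserving_pi (f := fun (_ : Fin (R.n i)) (x : Fin D → ℝ) => S *ᵥ x) _ _
      fun _ => ⟨hmul, hmap⟩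
  have hunit : ∀ᵐ Z ∂(stdDesign (R.n i) D), IsUnit (S * gram (Matrix.of Z) * Sᵀ) := by
    filter_upwards [hmp.quasiMeasurePreserving.ae (hR.gram_isUnit i)] with Z hZ
    rwa [gram_mulVec_rows] at hZ
  -- Invertibility of `S`, and thus of `Σ_i`, is inherited from the Gram matrix: `det S` divides its
  -- determinant, and one good `Z` suffices.
  have hSu : IsUnit S.det := by
    obtain ⟨Z, hZ⟩ := hunit.exists
    rw [Matrix.isUnit_iff_isUnit_det, Matrix.det_mul, Matrix.det_mul, mul_assoc] at hZ
    exact isUnit_of_mul_isUnit_left hZ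
  have hGu : ∀ᵐ Z ∂(stdDesign (R.n i) D), IsUnit (gram (Matrix.of Z)) := by
    filter_upwards [hunit] with Z hZ
    rw [Matrix.isUnit_iff_isUnit_det, Matrix.det_mul, Matrix.det_mul] at hZ
    exact (Matrix.isUnit_iff_isUnit_det _).2
      (isUnit_of_mul_isUnit_right (isUnit_of_mul_isUnit_left hZ))
  -- Each entry is a fixed linear combination of entries for the standard design, so integrability
  -- and expectation carry over.
  have hentry : ∀ (a b : Fin D) (Z : Fin (R.n i) → Fin D → ℝ),
      (gram (Matrix.of fun l => S *ᵥ Z l))⁻¹ a b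
        = ∑ c, ∑ d, (Sᵀ)⁻¹ a d * S⁻¹ c b * (gram (Matrix.of Z))⁻¹ d c := by
    intro a b Z
    rw [gram_mulVec_rows, Matrix.mul_inv_rev, Matrix.mul_inv_rev, ← Matrix.mul_assoc,
      Matrix.mul_apply]
    refine Finset.sum_congr rfl fun c _ => ?_
    rw [Matrix.mul_apply, Finset.sum_mul]
    exact Finset.sum_congr rfl fun d _ => by ring
  have hint : ∀ (a b c d : Fin D), Integrable (fun Z : Fin (R.n i) → Fin D → ℝ =>
      (Sᵀ)⁻¹ a d * S⁻¹ c b * (gram (Matrix.of Z))⁻¹ d c) (stdDesign (R.n i) D) :=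
    fun a b c d => (integrable_gram_inv_stdDesign hn hGu d c).const_mul _
  have hsec : R.secondMoment i = S * Sᵀ := hS.symm
  refine ⟨?_, fun a b => ?_, ?_⟩
  · rw [hsec, Matrix.isUnit_iff_isUnit_det, Matrix.det_mul, Matrix.det_transpose]
    exact hSu.mul hSu
  · rw [← hmp.map_eq, integrable_map_measure (measurable_gram_inv_apply a b).aestronglyMeasurable
      hmp.measurable.aemeasurable]
    refine Integrable.congr (integrable_finsetSum _ fun c _ => integrable_finsetSum _ fun d _ =>
      hint a b c d) (Filter.Eventually.of_forall fun Z => (hentry a b Z).symm)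
  · ext a b
    change ∫ X, (gram (Matrix.of X))⁻¹ a b ∂(R.designLaw i) = _
    rw [← hmp.map_eq, integral_map hmp.measurable.aemeasurable
      (measurable_gram_inv_apply a b).aestronglyMeasurable]
    simp_rw [hentry]
    rw [integral_finsetSum _ fun c _ => integrable_finsetSum _ fun d _ => hint a b c d]
    simp_rw [integral_finsetSum _ fun d _ => hint a b _ d, integral_const_mul,
      integral_gram_inv_stdDesign hn hGu]
    rw [hsec, Matrix.mul_inv_rev, Matrix.smul_apply, Matrix.mul_apply, smul_eq_mul, Finset.mul_sum]
    refine Finset.sum_congr rfl fun c _ => ?_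
    simp [mul_comm]

theorem Standing.varianceTerm_eq_of_isGaussian (hR : R.Standing)
    (hG : ∀ i, IsGaussian (R.inputDist i)) (h0 : ∀ i d, ∫ x, x d ∂(R.inputDist i) = 0)
    (hn : ∀ i, D + 1 < R.n i) (v : Fin M → ℝ) (j : Fin M) :
    R.varianceTerm v j = R.meanNoise * ∑ i, v i ^ 2 *
      ((R.secondMoment j * (R.secondMoment i)⁻¹).trace / ((R.n i : ℝ) - D - 1)) := by
  rw [varianceTerm]
  congr 1
  refine Finset.sum_congr rfl fun i _ => ?_
  rw [(hR.invGramIntegrable_and_expInvGram_eq i (hG i) (h0 i) (hn i)).2.2, Matrix.mul_smul,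
    Matrix.trace_smul, smul_eq_mul]
  ring

/-- Where `v i ≠ 0` the trace is that of `Σ_j Σ_j⁻¹ = 1`; the other players contribute nothing. -/
theorem Standing.varianceTerm_eq_of_isGaussian_of_secondMoment_eq (hR : R.Standing)
    (hG : ∀ i, IsGaussian (R.inputDist i)) (h0 : ∀ i d, ∫ x, x d ∂(R.inputDist i) = 0)
    (hn : ∀ i, D + 1 < R.n i) (v : Fin M → ℝ) (j : Fin M)
    (hv : ∀ i, v i ≠ 0 → R.secondMoment i = R.secondMoment j) :
    R.varianceTerm v j = R.meanNoise * ∑ i, v i ^ 2 * ((D : ℝ) / ((R.n i : ℝ) - D - 1)) := by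
  rw [hR.varianceTerm_eq_of_isGaussian hG h0 hn]
  congr 1
  refine Finset.sum_congr rfl fun i _ => ?_
  by_cases hi : v i = 0
  · simp [hi]
  · have hu := (hR.invGramIntegrable_and_expInvGram_eq j (hG j) (h0 j) (hn j)).1
    rw [hv i hi, Matrix.mul_nonsing_inv _ ((Matrix.isUnit_iff_isUnit_det _).1 hu),
      Matrix.trace_one, Fintype.card_fin]

end RegressionModel

end Federation

theorem theorem2 {M D : ℕ} (j : Fin M) (v : Fin M → Fin M → ℝ) (hv : ∑ i, v j i = 1) :
    -- linear regression
    (∀ R : Federation.RegressionModel M D, R.Standing →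
      ((∀ i, R.InvGramIntegrable i) →
        Integrable (R.sqError (v j) j) (R.jointLaw j) ∧
        R.expectedMSE (v j) j =
          R.varianceTerm (v j) j +
            Federation.biasWeight (v j) j *
              ∑ d, (∫ x, x d ^ 2 ∂(R.inputDist j)) * R.coeffVar d) ∧
      -- centred normal inputs
      ((∀ i, IsGaussian (R.inputDist i)) → (∀ i d, ∫ x, x d ∂(R.inputDist i) = 0) →
        (∀ i, D + 1 < R.n i) →
        (∀ i, R.InvGramIntegrable i) ∧
        R.varianceTerm (v j) j =
          R.meanNoise * ∑ i, v j i ^ 2 *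
            ((R.secondMoment j * (R.secondMoment i)⁻¹).trace / ((R.n i : ℝ) - D - 1)) ∧
        ((∀ i, v j i ≠ 0 → R.secondMoment i = R.secondMoment j) →
          R.varianceTerm (v j) j =
            R.meanNoise * ∑ i, v j i ^ 2 * ((D : ℝ) / ((R.n i : ℝ) - D - 1))))) ∧
    -- mean estimation
    (∀ R : Federation.MeanModel M, R.Standing →
      Integrable (R.sqError (v j) j) (Measure.pi R.playerLaw) ∧
      R.expectedMSE (v j) j =
        R.meanNoise * ∑ i, v j i ^ 2 * (1 / (R.n i : ℝ)) +
          Federation.biasWeight (v j) j * R.meanVar) := by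
  refine ⟨fun R hR => ⟨fun hi => hR.integrable_sqError_and_expectedMSE_eq hi j hv,
    fun hG h0 hn => ⟨fun i =>
      (hR.invGramIntegrable_and_expInvGram_eq i (hG i) (h0 i) (hn i)).2.1,
      hR.varianceTerm_eq_of_isGaussian hG h0 hn (v j) j,
      hR.varianceTerm_eq_of_isGaussian_of_secondMoment_eq hG h0 hn (v j) j⟩⟩,
    fun R hR => hR.integrable_sqError_and_expectedMSE_eq j hv⟩
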